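/- Let $X=(X,\mathcal O_X)$ be a split superscheme. Here a superscheme is a topological space $X$ with a sheaf of supercommutative $\mathbb Z/2$-graded rings $\mathcal O_X=\mathcal O_{X,0}\oplus\mathcal O_{X,1}$ (so $ab=-ba$ for odd sections $a,b$, and even sections are central), with local stalks, such that $(X,\mathcal O_{X,0})$ is a scheme and $\mathcal O_{X,1}$ is a coherent (quasi-coherent and of finite type) $\mathcal O_{X,0}$-module; it is split if, with $J_X=\mathcal O_X\cdot\mathcal O_{X,1}$, the sheaf $\mathrm{Gr}\,X=\bigoplus_{i\ge 0}J_X^i/J_X^{i+1}$ with its grading modulo $2$ is isomorphic to $\mathcal O_X$ as a sheaf of superrings on $X$. Let $\mathrm{QCoh}(X)$ be the category of $\mathbb Z/2$-graded sheaves of $\mathcal O_X$-modules $\mathcal F=\mathcal F_0\oplus\mathcal F_1$ whose even and odd parts are quasi-coherent $\mathcal O_{X,0}$-modules, with grading-preserving morphisms, and let $\mathcal D_{qc}(X)=D(\mathrm{QCoh}(X))$ be its unbounded derived category. For a closed subset $Z\subseteq X$ let $\mathcal D_{qc,Z}(X)\subseteq\mathcal D_{qc}(X)$ be the full triangulated subcategory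 of all objects $\mathcal F$ whose homological support $\mathrm{supph}(\mathcal F)=\bigcup_{n\in\mathbb Z}\{x\in X: H^n(\mathcal F)_x\neq 0\}$ is contained in $Z$. Let $Z\subseteq X$ be a closed subset whose open complement $U=X\setminus Z$ is such that the inclusion $j:U\hookrightarrow X$ is quasi-compact (this is automatic if the space $X$ is noetherian), and regard $U$ as the superscheme $(U,\mathcal O_X|_U)$. Then the restriction functor $j^*:\mathcal D_{qc}(X)\to\mathcal D_{qc}(U)$ vanishes on $\mathcal D_{qc,Z}(X)$, and the induced functor from the Verdier quotient $$\mathcal D_{qc}(X)/\mathcal D_{qc,Z}(X)\longrightarrow\mathcal D_{qc}(U)$$ is an equivalence of categories. -/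

import Mathlib

open CategoryTheory Limits AlgebraicGeometry TopologicalSpace Opposite

universe u

noncomputable section

/-- A sheaf of supercommutative `ℤ/2`-graded rings `O = O₀ ⊕ O₁` on a topological space `X` such that
`(X, O₀)` is a scheme (`even`), written out in terms of its two homogeneous parts: a sheaf `O₁` (`odd`)
of `O₀`-modules, together with an `O₀`-bilinear product `O₁ × O₁ → O₀`, compatible
with restriction, which is associative and satisfies `a * b = - b * a` for odd `a`, `b`.
The remaining products are the ring structure of `O₀` and the (two-sided, since even sections are
central) action of `O₀` on `O₁`; see `Sections`. -/
structure SuperRingedScheme where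
  even : Scheme.{u}
  odd : even.Modules
  mul (V : even.Opens) : Γ(odd, V) →ₗ[Γ(even, V)] Γ(odd, V) →ₗ[Γ(even, V)] Γ(even, V)
  map_mul {V W : even.Opens} (i : W ⟶ V) (a b : Γ(odd, V)) :
    even.presheaf.map i.op (mul V a b) =
      mul W (odd.presheaf.map i.op a) (odd.presheaf.map i.op b)
  mul_anticomm (V : even.Opens) (a b : Γ(odd, V)) : mul V a b = -mul V b a
  mul_assoc (V : even.Opens) (a b c : Γ(odd, V)) : mul V a b • c = mul V b c • a

namespace SuperRingedScheme

variable (X : SuperRingedScheme.{u})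

/-- The superring `O(V) = O₀(V) ⊕ O₁(V)` of sections over an open subset `V`. -/
@[ext]
structure Sections (V : X.even.Opens) where
  even : Γ(X.even, V)
  odd : Γ(X.odd, V)

namespace Sections

variable {X} {V : X.even.Opens}

instance : Zero (X.Sections V) := ⟨⟨0, 0⟩⟩
instance : One (X.Sections V) := ⟨⟨1, 0⟩⟩
instance : Add (X.Sections V) := ⟨fun a b => ⟨a.even + b.even, a.odd + b.odd⟩⟩
instance : Neg (X.Sections V) := ⟨fun a => ⟨-a.even, -a.odd⟩⟩
instance : Mul (X.Sections V) := ⟨fun a b =>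
  ⟨a.even * b.even + X.mul V a.odd b.odd, a.even • b.odd + b.even • a.odd⟩⟩

@[simp] lemma zero_even : (0 : X.Sections V).even = 0 := rfl
@[simp] lemma zero_odd : (0 : X.Sections V).odd = 0 := rfl
@[simp] lemma one_even : (1 : X.Sections V).even = 1 := rfl
@[simp] lemma one_odd : (1 : X.Sections V).odd = 0 := rfl
@[simp] lemma add_even (a b : X.Sections V) : (a + b).even = a.even + b.even := rfl
@[simp] lemma add_odd (a b : X.Sections V) : (a + b).odd = a.odd + b.odd := rfl
@[simp] lemma neg_even (a : X.Sections V) : (-a).even = -a.even := rfl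
@[simp] lemma neg_odd (a : X.Sections V) : (-a).odd = -a.odd := rfl
@[simp] lemma mul_even (a b : X.Sections V) :
    (a * b).even = a.even * b.even + X.mul V a.odd b.odd := rfl
@[simp] lemma mul_odd (a b : X.Sections V) :
    (a * b).odd = a.even • b.odd + b.even • a.odd := rfl

instance : Ring (X.Sections V) where
  add_assoc a b c := by ext <;> simp [add_assoc]
  zero_add a := by ext <;> simp
  add_zero a := by ext <;> simp
  add_comm a b := by ext <;> simp [add_comm]
  neg_add_cancel a := by ext <;> simp
  left_distrib a b c := by
    ext
    · simp only [mul_even, add_even, add_odd, map_add]; ring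
    · simp only [mul_odd, add_even, add_odd, smul_add, add_smul]; abel
  right_distrib a b c := by
    ext
    · simp only [mul_even, add_even, add_odd, map_add, LinearMap.add_apply]; ring
    · simp only [mul_odd, add_even, add_odd, smul_add, add_smul]; abel
  zero_mul a := by ext <;> simp
  mul_zero a := by ext <;> simp
  one_mul a := by ext <;> simp
  mul_one a := by ext <;> simp
  mul_assoc a b c := by
    ext
    · simp only [mul_even, mul_odd, map_add, map_smul, LinearMap.add_apply, LinearMap.smul_apply,
        smul_eq_mul]
      ring
    · simp only [mul_even, mul_odd, smul_add, add_smul, mul_smul, X.mul_assoc V a.odd b.odd c.odd]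
      rw [smul_comm c.even a.even, smul_comm c.even b.even]
      abel
  nsmul := nsmulRec
  zsmul := zsmulRec

end Sections

/-- Restriction of sections, as a ring homomorphism `O(V) → O(W)`. -/
def resSections {V W : X.even.Opens} (i : W ⟶ V) : X.Sections V →+* X.Sections W where
  toFun a := ⟨X.even.presheaf.map i.op a.even, X.odd.presheaf.map i.op a.odd⟩
  map_zero' := by ext <;> simp
  map_one' := by ext <;> simp
  map_add' a b := by ext <;> simp
  map_mul' a b := by ext <;> simp [X.map_mul]

/-- The structure sheaf `O = O₀ ⊕ O₁` as a presheaf of rings. -/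
def structurePresheaf : TopCat.Presheaf RingCat.{u} X.even where
  obj V := RingCat.of (X.Sections V.unop)
  map i := RingCat.ofHom (X.resSections i.unop)
  map_id V := by
    ext a
    · exact congr($(X.even.presheaf.map_id V) a.even)
    · exact congr($(X.odd.presheaf.map_id V) a.odd)
  map_comp i j := by
    ext a
    · exact congr($(X.even.presheaf.map_comp i j) a.even)
    · exact congr($(X.odd.presheaf.map_comp i j) a.odd)

/-- `(X, O₀ ⊕ O₁)` is a superscheme: `(X, O₀)` is a scheme, `O₁` is a coherent `O₀`-module
(quasi-coherent and of finite type) and the stalks of `O` are local rings. -/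
class IsSuperscheme : Prop where
  odd_quasicoherent : X.odd.IsQuasicoherent
  odd_finiteType : X.odd.IsFiniteType
  isLocalRing_stalk (x : X.even) : IsLocalRing (X.structurePresheaf.stalk x)

/-- The ideal `J(V)` of `O(V)` generated by the odd sections. -/
def oddIdeal (V : X.even.Opens) : Ideal (X.Sections V) :=
  Ideal.span {s | s.even = 0}

instance (V : X.even.Opens) : (X.oddIdeal V).IsTwoSided where
  mul_mem_of_left {a} b ha := by
    refine Submodule.span_induction (p := fun a _ => a * b ∈ X.oddIdeal V) ?_ ?_ ?_ ?_ ha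
    · intro s (hs : s.even = 0)
      have : s * b = ⟨b.even, - b.odd⟩ * s := by
        ext
        · simp [hs, X.mul_anticomm V s.odd b.odd]
        · simp [hs]
      rw [this]
      exact Ideal.mul_mem_left _ _ (Ideal.subset_span hs)
    · simp
    · intro x y _ _ hx hy
      rw [add_mul]; exact add_mem hx hy
    · intro r x _ hx
      rw [smul_eq_mul, _root_.mul_assoc]; exact Ideal.mul_mem_left _ _ hx

lemma resSections_mem_oddIdeal_pow {V W : X.even.Opens} (i : W ⟶ V) (n : ℕ) {s : X.Sections V}
    (hs : s ∈ X.oddIdeal V ^ n) : X.resSections i s ∈ X.oddIdeal W ^ n := by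
  have h1 : X.oddIdeal V ≤ (X.oddIdeal W).comap (X.resSections i) := by
    refine Ideal.span_le.2 fun a (ha : a.even = 0) => Ideal.subset_span ?_
    simp [resSections, ha]
  induction n generalizing s with
  | zero => simp [Submodule.pow_zero]
  | succ n ih =>
    rw [Ideal.IsTwoSided.pow_succ] at hs ⊢
    refine Submodule.smul_induction_on hs ?_ ?_
    · intro a ha b hb
      rw [smul_eq_mul, _root_.map_mul]
      exact Ideal.mul_mem_mul (h1 ha) (ih hb)
    · intro x y hx hy
      rw [map_add]; exact add_mem hx hy

/-- The Rees ring `⨁ i, J(V) ^ i`, as the ring of polynomials with `i`-th coefficient in `J(V) ^ i`. -/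
def rees (V : X.even.Opens) : Subring (Polynomial (X.Sections V)) where
  carrier := {p | ∀ i, p.coeff i ∈ X.oddIdeal V ^ i}
  zero_mem' i := by simp
  one_mem' i := by
    rw [Polynomial.coeff_one]
    split_ifs with h
    · subst h; simp [Submodule.pow_zero]
    · simp
  add_mem' hp hq i := by
    rw [Polynomial.coeff_add]; exact add_mem (hp i) (hq i)
  neg_mem' hp i := by
    rw [Polynomial.coeff_neg]; exact neg_mem (hp i)
  mul_mem' hp hq i := by
    rw [Polynomial.coeff_mul]
    refine sum_mem fun jk hjk => ?_
    rw [← Finset.HasAntidiagonal.mem_antidiagonal.1 hjk, Ideal.IsTwoSided.pow_add]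
    exact Ideal.mul_mem_mul (hp _) (hq _)

/-- The ideal `⨁ i, J(V) ^ (i + 1)` of the Rees ring `⨁ i, J(V) ^ i`. -/
def grIdeal (V : X.even.Opens) : Ideal (X.rees V) where
  carrier := {p | ∀ i, p.1.coeff i ∈ X.oddIdeal V ^ (i + 1)}
  zero_mem' i := by simp
  add_mem' hp hq i := by
    simpa using add_mem (hp i) (hq i)
  smul_mem' c p hp i := by
    simp only [smul_eq_mul, Subring.coe_mul, Polynomial.coeff_mul]
    refine sum_mem fun jk hjk => ?_
    rw [← Finset.HasAntidiagonal.mem_antidiagonal.1 hjk, add_assoc, Ideal.IsTwoSided.pow_add]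
    exact Ideal.mul_mem_mul (c.2 _) (hp _)

instance (V : X.even.Opens) : (X.grIdeal V).IsTwoSided where
  mul_mem_of_left {p} q hp i := by
    simp only [Subring.coe_mul, Polynomial.coeff_mul]
    refine sum_mem fun jk hjk => ?_
    rw [← Finset.HasAntidiagonal.mem_antidiagonal.1 hjk, add_right_comm, Ideal.IsTwoSided.pow_add]
    exact Ideal.mul_mem_mul (hp _) (q.2 _)

/-- The associated graded ring `⨁ i, J(V) ^ i / J(V) ^ (i + 1)` of `O(V)`. -/
abbrev Gr (V : X.even.Opens) : Type u := X.rees V ⧸ X.grIdeal V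

/-- Restriction maps of the Rees rings. -/
def reesRes {V W : X.even.Opens} (i : W ⟶ V) : X.rees V →+* X.rees W :=
  ((Polynomial.mapRingHom (X.resSections i)).comp (X.rees V).subtype).codRestrict (X.rees W)
    fun p n => by
      simpa using X.resSections_mem_oddIdeal_pow i n (p.2 n)

lemma reesRes_coeff {V W : X.even.Opens} (i : W ⟶ V) (p : X.rees V) (n : ℕ) :
    (X.reesRes i p).1.coeff n = X.resSections i (p.1.coeff n) :=
  Polynomial.coeff_map _ _

/-- Restriction maps of the associated graded rings. -/
def grRes {V W : X.even.Opens} (i : W ⟶ V) : X.Gr V →+* X.Gr W :=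
  Ideal.Quotient.lift (X.grIdeal V) ((Ideal.Quotient.mk (X.grIdeal W)).comp (X.reesRes i))
    fun p hp => Ideal.Quotient.eq_zero_iff_mem.2 fun n => by
      rw [reesRes_coeff]
      exact X.resSections_mem_oddIdeal_pow i (n + 1) (hp n)

/-- The class in `J(V) ^ n / J(V) ^ (n + 1)`, the degree `n` part of `Gr V`, of a section in `J(V) ^ n`. -/
def grMk (V : X.even.Opens) (n : ℕ) (s : X.Sections V) (hs : s ∈ X.oddIdeal V ^ n) : X.Gr V :=
  Ideal.Quotient.mk (X.grIdeal V) ⟨Polynomial.monomial n s, fun i => by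
    rw [Polynomial.coeff_monomial]
    split_ifs with h
    · exact h ▸ hs
    · exact zero_mem _⟩

/-- The presheaf `V ↦ ⨁ i, J(V) ^ i / J(V) ^ (i + 1)`; its associated sheaf is the sheaf
`Gr X = ⨁ i, J ^ i / J ^ (i + 1)`. -/
def grPresheaf : TopCat.Presheaf RingCat.{u} X.even where
  obj V := RingCat.of (X.Gr V.unop)
  map i := RingCat.ofHom (X.grRes i.unop)
  map_id V := by
    ext p
    refine congr_arg (Ideal.Quotient.mk _) (Subtype.ext (Polynomial.ext fun n => ?_))
    exact (X.reesRes_coeff _ p n).trans congr($(X.structurePresheaf.map_id V) (p.1.coeff n))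
  map_comp i j := by
    ext p
    refine congr_arg (Ideal.Quotient.mk _) (Subtype.ext (Polynomial.ext fun n => ?_))
    rw [reesRes_coeff, reesRes_coeff, reesRes_coeff]
    exact congr($(X.structurePresheaf.map_comp i j) (p.1.coeff n))

/-- `X` is split: the sheaf `Gr X`, graded by the degree modulo `2`, is isomorphic to `O` as a sheaf of
superrings. A morphism from the sheaf associated with `grPresheaf` to the sheaf `O` is the same as a
morphism `φ` of presheaves; it is a morphism of superrings when classes of even (odd) degree have even
(odd) images, and it is an isomorphism exactly when `φ` is bijective on all stalks. -/
def IsSplit : Prop :=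
  ∃ φ : X.grPresheaf ⟶ X.structurePresheaf,
    (∀ (V : X.even.Opens) (n : ℕ) (s : X.Sections V) (hs : s ∈ X.oddIdeal V ^ n),
      (Even n → ((φ.app (op V)) (X.grMk V n s hs) : X.Sections V).odd = 0) ∧
      (¬ Even n → ((φ.app (op V)) (X.grMk V n s hs) : X.Sections V).even = 0)) ∧
    ∀ x : X.even, IsIso ((TopCat.Presheaf.stalkFunctor RingCat.{u} x).map φ)

/-- A sheaf of (`ℤ/2`-graded) modules `M = M₀ ⊕ M₁` over `O = O₀ ⊕ O₁`: two sheaves of `O₀`-modules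
`M₀` (`even`) and `M₁` (`odd`) with bilinear products `O₁ × M₀ → M₁` (`actEven`) and
`O₁ × M₁ → M₀` (`actOdd`), compatible with restriction and associative. -/
structure SuperModule (X : SuperRingedScheme.{u}) where
  even : X.even.Modules
  odd : X.even.Modules
  actEven (V : X.even.Opens) :
    Γ(X.odd, V) →ₗ[Γ(X.even, V)] Γ(even, V) →ₗ[Γ(X.even, V)] Γ(odd, V)
  actOdd (V : X.even.Opens) :
    Γ(X.odd, V) →ₗ[Γ(X.even, V)] Γ(odd, V) →ₗ[Γ(X.even, V)] Γ(even, V)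
  map_actEven {V W : X.even.Opens} (i : W ⟶ V) (a : Γ(X.odd, V)) (m : Γ(even, V)) :
    odd.presheaf.map i.op (actEven V a m) =
      actEven W (X.odd.presheaf.map i.op a) (even.presheaf.map i.op m)
  map_actOdd {V W : X.even.Opens} (i : W ⟶ V) (a : Γ(X.odd, V)) (m : Γ(odd, V)) :
    even.presheaf.map i.op (actOdd V a m) =
      actOdd W (X.odd.presheaf.map i.op a) (odd.presheaf.map i.op m)
  actOdd_actEven (V : X.even.Opens) (a b : Γ(X.odd, V)) (m : Γ(even, V)) :
    actOdd V a (actEven V b m) = X.mul V a b • m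
  actEven_actOdd (V : X.even.Opens) (a b : Γ(X.odd, V)) (m : Γ(odd, V)) :
    actEven V a (actOdd V b m) = X.mul V a b • m

/-- Presentations are transported along isomorphisms. -/
def presentationOfIso {A : Scheme.{u}} {M N : A.Modules} (e : M ≅ N)
    (p : SheafOfModules.Presentation M) : SheafOfModules.Presentation N :=
  have h : IsIso e.hom := inferInstance
  @SheafOfModules.Presentation.ofIsIso.{u, u, u} _ _ _ _ _ _ _ _ e.hom h p

lemma isQuasicoherent_of_cover {A : Scheme.{u}} (M : A.Modules)
    (h : ∀ x : A, ∃ V : A.Opens, x ∈ V ∧ Nonempty (M.restrict V.ι).Presentation) :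
    M.IsQuasicoherent := by
  choose V hV hp using h
  refine SheafOfModules.QuasicoherentData.isQuasicoherent (M := M)
    { I := A, X := V, coversTop := ?_, presentation := fun x => ?_ }
  · rw [Opens.coversTop_iff]
    exact top_le_iff.1 fun x _ => Opens.mem_iSup.2 ⟨x, hV x⟩
  · let e := Scheme.Modules.overEquiv (V x)
    let p : SheafOfModules.Presentation (e.functor.obj (M.over (V x))) :=
      presentationOfIso ((Scheme.Modules.overFunctorEquiv (V x)).app M).symm (hp x).some
    let F : SheafOfModules.{u} (V x : Scheme.{u}).ringCatSheaf ⥤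
      SheafOfModules.{u} (A.ringCatSheaf.over (V x)) := e.inverse
    have : PreservesColimitsOfSize.{u, u} F := e.symm.toAdjunction.leftAdjoint_preservesColimits
    let η : e.functor.obj (SheafOfModules.unit _) ≅ SheafOfModules.unit _ :=
      (Scheme.Modules.overFunctorEquiv (V x)).app (SheafOfModules.unit _) ≪≫
      Scheme.Modules.restrictUnitIso (V x).ι
    let p' := p.map F (e.unitIso.app _ ≪≫ e.inverse.mapIso η)
    exact SheafOfModules.Presentation.ofIsIso.{u, u, u} (e.unitIso.app (M.over (V x))).inv p'

lemma isQuasicoherent_of_affine {A : Scheme.{u}} (M : A.Modules)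
    (h : ∀ (R : CommRingCat.{u}) (f : Spec R ⟶ A) [IsOpenImmersion f],
      ∃ B : ModuleCat.{u} R, Nonempty (tilde B ≅ M.restrict f)) :
    M.IsQuasicoherent := by
  refine isQuasicoherent_of_cover M fun x => ?_
  obtain ⟨V, hV, hx, -⟩ := exists_isAffineOpen_mem_and_subset (X := A) (x := x) (U := ⊤) trivial
  refine ⟨V, hx, ?_⟩
  obtain ⟨B, ⟨e⟩⟩ := h _ (hV.isoSpec.inv ≫ V.ι)
  let p : (M.restrict (hV.isoSpec.inv ≫ V.ι)).Presentation :=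
    presentationOfIso e (presentationTilde _ .univ (by simp) _ (Submodule.span_eq _))
  have hf : hV.isoSpec.hom ≫ hV.isoSpec.inv ≫ V.ι = V.ι := by simp
  let i := (Scheme.Modules.restrictFunctorComp hV.isoSpec.hom (hV.isoSpec.inv ≫ V.ι)).symm ≪≫
      Scheme.Modules.restrictFunctorCongr hf
  exact ⟨presentationOfIso (i.app M)
    (Scheme.Modules.presentationRestrict hV.isoSpec.hom p)⟩

instance isQuasicoherent_biprod {A : Scheme.{u}} (M N : A.Modules) [M.IsQuasicoherent]
    [N.IsQuasicoherent] : (M ⊞ N).IsQuasicoherent := by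
  refine isQuasicoherent_of_affine _ fun R f _ => ?_
  have : PreservesBinaryBiproducts (Scheme.Modules.restrictFunctor f) :=
    preservesBinaryBiproducts_of_preservesBinaryCoproducts _
  have : PreservesBinaryBiproducts (tilde.functor R) :=
    preservesBinaryBiproducts_of_preservesBinaryCoproducts _
  let e₁ := asIso (Scheme.Modules.fromTildeΓ (M.restrict f))
  let e₂ := asIso (Scheme.Modules.fromTildeΓ (N.restrict f))
  exact ⟨_, ⟨(tilde.functor R).mapBiprod _ _ ≪≫ biprod.mapIso e₁ e₂ ≪≫
    ((Scheme.Modules.restrictFunctor f).mapBiprod M N).symm⟩⟩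

open ZeroObject in
instance isQuasicoherent_zero {A : Scheme.{u}} : (0 : A.Modules).IsQuasicoherent := by
  refine isQuasicoherent_of_affine _ fun R f _ => ?_
  have : (Scheme.Modules.restrictFunctor f).PreservesZeroMorphisms :=
    Functor.preservesZeroMorphisms_of_isLeftAdjoint _
  exact ⟨0, ⟨(tilde.functor R).mapZeroObject ≪≫
    (Scheme.Modules.restrictFunctor f).mapZeroObject.symm⟩⟩

namespace SuperModule

variable {X : SuperRingedScheme.{u}}

/-- Morphisms of sheaves of modules which preserve the grading. -/
@[ext]
structure Hom (M N : SuperModule X) where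
  even : M.even ⟶ N.even
  odd : M.odd ⟶ N.odd
  app_actEven (V : X.even.Opens) (a : Γ(X.odd, V)) (m : Γ(M.even, V)) :
    odd.app V (M.actEven V a m) = N.actEven V a (even.app V m) := by cat_disch
  app_actOdd (V : X.even.Opens) (a : Γ(X.odd, V)) (m : Γ(M.odd, V)) :
    even.app V (M.actOdd V a m) = N.actOdd V a (odd.app V m) := by cat_disch

attribute [simp] Hom.app_actEven Hom.app_actOdd

@[simps id_even id_odd comp_even comp_odd]
instance : Category (SuperModule X) where
  Hom := Hom
  id M := { even := 𝟙 M.even, odd := 𝟙 M.odd }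
  comp f g := { even := f.even ≫ g.even, odd := f.odd ≫ g.odd }

@[ext]
lemma hom_ext {M N : SuperModule X} {f g : M ⟶ N} (h₀ : f.even = g.even) (h₁ : f.odd = g.odd) :
    f = g := Hom.ext h₀ h₁

section

variable {M N : SuperModule X}

instance : Zero (M ⟶ N) := ⟨{ even := 0, odd := 0 }⟩
instance : Add (M ⟶ N) := ⟨fun f g => { even := f.even + g.even, odd := f.odd + g.odd }⟩
instance : Neg (M ⟶ N) := ⟨fun f =>
  { even := -f.even
    odd := -f.odd
    app_actEven V a m := by
      change -(f.odd.app V (M.actEven V a m)) = N.actEven V a (-(f.even.app V m))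
      simp
    app_actOdd V a m := by
      change -(f.even.app V (M.actOdd V a m)) = N.actOdd V a (-(f.odd.app V m))
      simp }⟩

@[simp] lemma zero_even : (0 : M ⟶ N).even = 0 := rfl
@[simp] lemma zero_odd : (0 : M ⟶ N).odd = 0 := rfl
@[simp] lemma add_even (f g : M ⟶ N) : (f + g).even = f.even + g.even := rfl
@[simp] lemma add_odd (f g : M ⟶ N) : (f + g).odd = f.odd + g.odd := rfl
@[simp] lemma neg_even (f : M ⟶ N) : (-f).even = -f.even := rfl
@[simp] lemma neg_odd (f : M ⟶ N) : (-f).odd = -f.odd := rfl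

instance : AddCommGroup (M ⟶ N) where
  add_assoc f g h := by ext1 <;> simp [add_assoc]
  zero_add f := by ext1 <;> simp
  add_zero f := by ext1 <;> simp
  add_comm f g := by ext1 <;> simp [add_comm]
  neg_add_cancel f := by ext1 <;> simp
  nsmul := nsmulRec
  zsmul := zsmulRec

end

instance : Preadditive (SuperModule X) where

variable (X) in
/-- The functor `M ↦ M₀`. -/
@[simps]
def evenPart : SuperModule X ⥤ X.even.Modules where
  obj M := M.even
  map f := f.even

variable (X) in
/-- The functor `M ↦ M₁`. -/
@[simps]
def oddPart : SuperModule X ⥤ X.even.Modules where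
  obj M := M.odd
  map f := f.odd

instance : (evenPart X).Additive where
instance : (oddPart X).Additive where

open ZeroObject in
variable (X) in
/-- The zero module. -/
def zero : SuperModule X where
  even := 0
  odd := 0
  actEven V := 0
  actOdd V := 0
  map_actEven := by simp
  map_actOdd := by simp
  actOdd_actEven V a b m := by
    have h : m = 0 := congr(($((isZero_zero X.even.Modules).eq_of_src (𝟙 _) 0) :
      (0 : X.even.Modules) ⟶ 0).app V m)
    simp [h]
  actEven_actOdd V a b m := by
    have h : m = 0 := congr(($((isZero_zero X.even.Modules).eq_of_src (𝟙 _) 0) :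
      (0 : X.even.Modules) ⟶ 0).app V m)
    simp [h]

open ZeroObject in
variable (X) in
lemma isZero_zero' : IsZero (zero X) := by
  rw [IsZero.iff_id_eq_zero]
  ext1
  · exact (isZero_zero X.even.Modules).eq_of_src _ _
  · exact (isZero_zero X.even.Modules).eq_of_src _ _

instance : HasZeroObject (SuperModule X) := ⟨zero X, isZero_zero' X⟩

section Biprod

variable {A : Scheme.{u}} {P Q : A.Modules} {V W : A.Opens}

/-- The linear map on sections defined by a morphism. -/
def appLinear (f : P ⟶ Q) (V : A.Opens) : Γ(P, V) →ₗ[Γ(A, V)] Γ(Q, V) where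
  toFun m := f.app V m
  map_add' := by simp
  map_smul' := by simp

@[simp] lemma appLinear_apply (f : P ⟶ Q) (V : A.Opens) (m : Γ(P, V)) :
    appLinear f V m = f.app V m := rfl

lemma app_map (f : P ⟶ Q) (i : W ⟶ V) (m : Γ(P, V)) :
    Q.presheaf.map i.op (f.app V m) = f.app W (P.presheaf.map i.op m) :=
  (congr($(f.mapPresheaf.naturality i.op) m)).symm

@[simp] lemma fst_app_inl (m : Γ(P, V)) :
    (biprod.fst : P ⊞ Q ⟶ P).app V ((biprod.inl : P ⟶ P ⊞ Q).app V m) = m :=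
  congr(($(biprod.inl_fst (X := P) (Y := Q)).app V) m)

@[simp] lemma snd_app_inl (m : Γ(P, V)) :
    (biprod.snd : P ⊞ Q ⟶ Q).app V ((biprod.inl : P ⟶ P ⊞ Q).app V m) = 0 :=
  congr(($(biprod.inl_snd (X := P) (Y := Q)).app V) m)

@[simp] lemma fst_app_inr (m : Γ(Q, V)) :
    (biprod.fst : P ⊞ Q ⟶ P).app V ((biprod.inr : Q ⟶ P ⊞ Q).app V m) = 0 :=
  congr(($(biprod.inr_fst (X := P) (Y := Q)).app V) m)

@[simp] lemma snd_app_inr (m : Γ(Q, V)) :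
    (biprod.snd : P ⊞ Q ⟶ Q).app V ((biprod.inr : Q ⟶ P ⊞ Q).app V m) = m :=
  congr(($(biprod.inr_snd (X := P) (Y := Q)).app V) m)

lemma biprod_app_total (m : Γ(P ⊞ Q, V)) :
    (biprod.inl : P ⟶ P ⊞ Q).app V ((biprod.fst : P ⊞ Q ⟶ P).app V m) +
      (biprod.inr : Q ⟶ P ⊞ Q).app V ((biprod.snd : P ⊞ Q ⟶ Q).app V m) = m :=
  congr(($(biprod.total (X := P) (Y := Q)).app V) m)

end Biprod

variable (M N : SuperModule X)

/-- The direct sum of two modules. -/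
def biprod : SuperModule X where
  even := M.even ⊞ N.even
  odd := M.odd ⊞ N.odd
  actEven V := ((M.actEven V).compl₂ (appLinear biprod.fst V)).compr₂ (appLinear biprod.inl V) +
    ((N.actEven V).compl₂ (appLinear biprod.snd V)).compr₂ (appLinear biprod.inr V)
  actOdd V := ((M.actOdd V).compl₂ (appLinear biprod.fst V)).compr₂ (appLinear biprod.inl V) +
    ((N.actOdd V).compl₂ (appLinear biprod.snd V)).compr₂ (appLinear biprod.inr V)
  map_actEven i a m := by simp [app_map, M.map_actEven, N.map_actEven]
  map_actOdd i a m := by simp [app_map, M.map_actOdd, N.map_actOdd]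
  actOdd_actEven V a b m := by
    conv_rhs => rw [← biprod_app_total m]
    simp [M.actOdd_actEven, N.actOdd_actEven]
  actEven_actOdd V a b m := by
    conv_rhs => rw [← biprod_app_total m]
    simp [M.actEven_actOdd, N.actEven_actOdd]

lemma biprod_actEven (V : X.even.Opens) (a : Γ(X.odd, V)) (m : Γ(M.even ⊞ N.even, V)) :
    (biprod M N).actEven V a m =
      (biprod.inl : M.odd ⟶ M.odd ⊞ N.odd).app V
          (M.actEven V a ((biprod.fst : M.even ⊞ N.even ⟶ M.even).app V m)) +
        (biprod.inr : N.odd ⟶ M.odd ⊞ N.odd).app V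
          (N.actEven V a ((biprod.snd : M.even ⊞ N.even ⟶ N.even).app V m)) := rfl

lemma biprod_actOdd (V : X.even.Opens) (a : Γ(X.odd, V)) (m : Γ(M.odd ⊞ N.odd, V)) :
    (biprod M N).actOdd V a m =
      (biprod.inl : M.even ⟶ M.even ⊞ N.even).app V
          (M.actOdd V a ((biprod.fst : M.odd ⊞ N.odd ⟶ M.odd).app V m)) +
        (biprod.inr : N.even ⟶ M.even ⊞ N.even).app V
          (N.actOdd V a ((biprod.snd : M.odd ⊞ N.odd ⟶ N.odd).app V m)) := rfl

/-- The first projection. -/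
def biprodFst : biprod M N ⟶ M where
  even := biprod.fst
  odd := biprod.fst
  app_actEven V a m := (congr_arg ((biprod.fst : M.odd ⊞ N.odd ⟶ M.odd).app V)
    (biprod_actEven M N V a m)).trans (by simp; rfl)
  app_actOdd V a m := (congr_arg ((biprod.fst : M.even ⊞ N.even ⟶ M.even).app V)
    (biprod_actOdd M N V a m)).trans (by simp; rfl)

/-- The second projection. -/
def biprodSnd : biprod M N ⟶ N where
  even := biprod.snd
  odd := biprod.snd
  app_actEven V a m := (congr_arg ((biprod.snd : M.odd ⊞ N.odd ⟶ N.odd).app V)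
    (biprod_actEven M N V a m)).trans (by simp; rfl)
  app_actOdd V a m := (congr_arg ((biprod.snd : M.even ⊞ N.even ⟶ N.even).app V)
    (biprod_actOdd M N V a m)).trans (by simp; rfl)

/-- The first inclusion. -/
def biprodInl : M ⟶ biprod M N where
  even := biprod.inl
  odd := biprod.inl
  app_actEven V a m := ((biprod_actEven M N V a
    ((biprod.inl : M.even ⟶ M.even ⊞ N.even).app V m)).trans (by simp; rfl)).symm
  app_actOdd V a m := ((biprod_actOdd M N V a
    ((biprod.inl : M.odd ⟶ M.odd ⊞ N.odd).app V m)).trans (by simp; rfl)).symm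

/-- The second inclusion. -/
def biprodInr : N ⟶ biprod M N where
  even := biprod.inr
  odd := biprod.inr
  app_actEven V a m := ((biprod_actEven M N V a
    ((biprod.inr : N.even ⟶ M.even ⊞ N.even).app V m)).trans (by simp; rfl)).symm
  app_actOdd V a m := ((biprod_actOdd M N V a
    ((biprod.inr : N.odd ⟶ M.odd ⊞ N.odd).app V m)).trans (by simp; rfl)).symm

/-- The direct sum as a biproduct. -/
def biprodBicone : BinaryBicone M N where
  pt := biprod M N
  fst := biprodFst M N
  snd := biprodSnd M N
  inl := biprodInl M N
  inr := biprodInr M N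
  inl_fst := by ext1 <;> exact biprod.inl_fst
  inl_snd := by ext1 <;> exact biprod.inl_snd
  inr_fst := by ext1 <;> exact biprod.inr_fst
  inr_snd := by ext1 <;> exact biprod.inr_snd

lemma biprodBicone_total :
    (biprodBicone M N).fst ≫ (biprodBicone M N).inl +
      (biprodBicone M N).snd ≫ (biprodBicone M N).inr = 𝟙 (biprodBicone M N).pt := by
  ext1 <;> exact biprod.total

instance : HasBinaryBiproducts (SuperModule X) where
  has_binary_biproduct M N :=
    .mk ⟨biprodBicone M N, isBinaryBilimitOfTotal _ (biprodBicone_total M N)⟩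

end SuperModule

namespace SuperModule

variable (X : SuperRingedScheme.{u})

/-- `M` is quasi-coherent if `M₀` and `M₁` are quasi-coherent on the scheme `(X, O₀)`. -/
def isQuasicoherent : ObjectProperty (SuperModule X) := fun M =>
  M.even.IsQuasicoherent ∧ M.odd.IsQuasicoherent

end SuperModule

/-- The category of quasi-coherent sheaves of modules on `X` and grading preserving morphisms. -/
abbrev QCoh (X : SuperRingedScheme.{u}) : Type (u + 1) :=
  (SuperModule.isQuasicoherent X).FullSubcategory

namespace QCoh

variable (X : SuperRingedScheme.{u})

instance : (SuperModule.isQuasicoherent X).ContainsZero where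
  exists_zero := ⟨SuperModule.zero X, SuperModule.isZero_zero' X,
    isQuasicoherent_zero, isQuasicoherent_zero⟩

instance : HasBinaryBiproducts (QCoh X) where
  has_binary_biproduct M N := by
    have := M.property.1
    have := M.property.2
    have := N.property.1
    have := N.property.2
    let b := SuperModule.biprodBicone M.obj N.obj
    let c : BinaryBicone M N :=
      { pt := ⟨b.pt, isQuasicoherent_biprod _ _, isQuasicoherent_biprod _ _⟩
        fst := ⟨b.fst⟩
        snd := ⟨b.snd⟩
        inl := ⟨b.inl⟩
        inr := ⟨b.inr⟩
        inl_fst := by ext1; exact b.inl_fst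
        inl_snd := by ext1; exact b.inl_snd
        inr_fst := by ext1; exact b.inr_fst
        inr_snd := by ext1; exact b.inr_snd }
    exact .mk ⟨c, isBinaryBilimitOfTotal _
      (by ext1; exact SuperModule.biprodBicone_total M.obj N.obj)⟩

/-- The functor `M ↦ M₀` on quasi-coherent modules. -/
def evenPart : QCoh X ⥤ X.even.Modules :=
  (SuperModule.isQuasicoherent X).ι ⋙ SuperModule.evenPart X

/-- The functor `M ↦ M₁` on quasi-coherent modules. -/
def oddPart : QCoh X ⥤ X.even.Modules :=
  (SuperModule.isQuasicoherent X).ι ⋙ SuperModule.oddPart X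

instance : (evenPart X).Additive := by unfold evenPart; infer_instance
instance : (oddPart X).Additive := by unfold oddPart; infer_instance

end QCoh

/-- The homotopy category of (unbounded) complexes of quasi-coherent modules on `X`. -/
abbrev KQCoh (X : SuperRingedScheme.{u}) : Type (u + 1) :=
  HomotopyCategory (QCoh X) (ComplexShape.up ℤ)

/-- The acyclic complexes: those whose even and odd parts are acyclic complexes of sheaves of
`O₀`-modules. -/
def acyclic (X : SuperRingedScheme.{u}) : ObjectProperty (KQCoh X) :=
  (HomotopyCategory.subcategoryAcyclic X.even.Modules).inverseImage
      ((QCoh.evenPart X).mapHomotopyCategory (ComplexShape.up ℤ)) ⊓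
    (HomotopyCategory.subcategoryAcyclic X.even.Modules).inverseImage
      ((QCoh.oddPart X).mapHomotopyCategory (ComplexShape.up ℤ))

instance (X : SuperRingedScheme.{u}) : (acyclic X).IsTriangulated := by
  unfold acyclic; infer_instance

/-- The derived category `D_qc(X) = D(QCoh(X))`: the Verdier quotient of the homotopy category by the
acyclic complexes, that is, its localization at the quasi-isomorphisms. -/
abbrev Dqc (X : SuperRingedScheme.{u}) : Type (u + 1) := (acyclic X).trW.Localization

section Restrict

lemma smul_restrict {A : Scheme.{u}} (U : A.Opens) (M : A.Modules) (V : U.toScheme.Opens)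
    (r : Γ(A, U.ι ''ᵁ V)) (m : Γ(M, U.ι ''ᵁ V)) :
    (HSMul.hSMul (α := Γ(U.toScheme, V)) (β := Γ(M.restrict U.ι, V))
      (γ := Γ(M.restrict U.ι, V)) r m) = (r • m : Γ(M, U.ι ''ᵁ V)) := by
  refine (Scheme.Modules.smul_restrictAppIso_hom_apply U.ι M V r m).trans ?_
  rw [Scheme.Opens.ι_appIso]
  rfl

section

variable {A : Scheme.{u}} (U : A.Opens)

/-- Restriction of a bilinear map of modules to an open subscheme. -/
def restrictBilin {P Q N : A.Modules} (V : U.toScheme.Opens)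
    (B : Γ(P, U.ι ''ᵁ V) →ₗ[Γ(A, U.ι ''ᵁ V)] Γ(Q, U.ι ''ᵁ V) →ₗ[Γ(A, U.ι ''ᵁ V)] Γ(N, U.ι ''ᵁ V)) :
    Γ(P.restrict U.ι, V) →ₗ[Γ(U.toScheme, V)] Γ(Q.restrict U.ι, V) →ₗ[Γ(U.toScheme, V)]
      Γ(N.restrict U.ι, V) :=
  LinearMap.mk₂ Γ(U.toScheme, V) (fun a b => (B a b : Γ(N, U.ι ''ᵁ V)))
    (fun a a' b => B.map_add₂ a a' b)
    (fun r a b => ((congr_arg (fun x => B x b) (smul_restrict U P V r a)).trans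
       (B.map_smul₂ r a b)).trans (smul_restrict U N V r _).symm)
    (fun a b b' => (B a).map_add b b')
    (fun r a b => ((congr_arg (fun x => B a x) (smul_restrict U Q V r b)).trans
       ((B a).map_smul r b)).trans (smul_restrict U N V r _).symm)

/-- Restriction of a bilinear form to an open subscheme. -/
def restrictForm {P : A.Modules} (V : U.toScheme.Opens)
    (B : Γ(P, U.ι ''ᵁ V) →ₗ[Γ(A, U.ι ''ᵁ V)] Γ(P, U.ι ''ᵁ V) →ₗ[Γ(A, U.ι ''ᵁ V)] Γ(A, U.ι ''ᵁ V)) :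
    Γ(P.restrict U.ι, V) →ₗ[Γ(U.toScheme, V)] Γ(P.restrict U.ι, V) →ₗ[Γ(U.toScheme, V)]
      Γ(U.toScheme, V) :=
  LinearMap.mk₂ Γ(U.toScheme, V) (fun a b => (B a b : Γ(A, U.ι ''ᵁ V)))
    (fun a a' b => B.map_add₂ a a' b)
    (fun r a b => ((congr_arg (fun x => B x b) (smul_restrict U P V r a)).trans
       (B.map_smul₂ r a b)))
    (fun a b b' => (B a).map_add b b')
    (fun r a b => ((congr_arg (fun x => B a x) (smul_restrict U P V r b)).trans
       ((B a).map_smul r b)))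

end

variable (X : SuperRingedScheme.{u}) (U : X.even.Opens)

/-- The open sub-superscheme `(U, O|_U)`. -/
def restrict : SuperRingedScheme.{u} where
  even := U
  odd := X.odd.restrict U.ι
  mul V := restrictForm U V (X.mul (U.ι ''ᵁ V))
  map_mul i a b := X.map_mul (U.ι.opensFunctor.map i) a b
  mul_anticomm V a b := X.mul_anticomm (U.ι ''ᵁ V) a b
  mul_assoc V a b c :=
    (smul_restrict U X.odd V _ _).trans
      ((X.mul_assoc (U.ι ''ᵁ V) a b c).trans (smul_restrict U X.odd V _ _).symm)

namespace SuperModule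

variable {X}

/-- The restriction `M|_U = j^* M` along the inclusion `j` of `U`. -/
def restrict (M : SuperModule X) : SuperModule (X.restrict U) where
  even := (M.even.restrict U.ι : U.toScheme.Modules)
  odd := (M.odd.restrict U.ι : U.toScheme.Modules)
  actEven V := restrictBilin U V (M.actEven (U.ι ''ᵁ V))
  actOdd V := restrictBilin U V (M.actOdd (U.ι ''ᵁ V))
  map_actEven i a m := M.map_actEven (U.ι.opensFunctor.map i) a m
  map_actOdd i a m := M.map_actOdd (U.ι.opensFunctor.map i) a m
  actOdd_actEven V a b m := (M.actOdd_actEven (U.ι ''ᵁ V) a b m).trans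
    (smul_restrict U M.even V _ _).symm
  actEven_actOdd V a b m := (M.actEven_actOdd (U.ι ''ᵁ V) a b m).trans
    (smul_restrict U M.odd V _ _).symm

/-- The exact functor `M ↦ M|_U`. -/
def restrictFunctor : SuperModule X ⥤ SuperModule (X.restrict U) where
  obj M := M.restrict U
  map f :=
    { even := (Scheme.Modules.restrictFunctor U.ι).map f.even
      odd := (Scheme.Modules.restrictFunctor U.ι).map f.odd
      app_actEven V a m := f.app_actEven (U.ι ''ᵁ V) a m
      app_actOdd V a m := f.app_actOdd (U.ι ''ᵁ V) a m }
  map_id _ := rfl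
  map_comp _ _ := rfl

instance : (restrictFunctor U : SuperModule X ⥤ _).Additive where
  map_add := rfl

lemma restrictFunctor_evenPart : restrictFunctor U ⋙ evenPart (X.restrict U) =
    evenPart X ⋙ Scheme.Modules.restrictFunctor U.ι := rfl

lemma restrictFunctor_oddPart : restrictFunctor U ⋙ oddPart (X.restrict U) =
    oddPart X ⋙ Scheme.Modules.restrictFunctor U.ι := rfl

end SuperModule

end Restrict

section Exact

lemma isZero_of_stalk {A : Scheme.{u}} (M : A.Modules)
    (h : ∀ x : A, IsZero ((Scheme.Modules.toPresheaf A ⋙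
      TopCat.Presheaf.stalkFunctor Ab.{u} x).obj M)) : IsZero M := by
  rw [IsZero.iff_id_eq_zero]
  refine Scheme.Modules.hom_ext _ _ fun V => ?_
  ext s
  refine TopCat.Presheaf.section_ext ⟨M.presheaf, M.isSheaf⟩ V _ _ fun x hx => ?_
  have := AddCommGrpCat.subsingleton_of_isZero (h x)
  exact Subsingleton.elim (α := ((Scheme.Modules.toPresheaf A ⋙
      TopCat.Presheaf.stalkFunctor Ab.{u} x).obj M)) _ _

instance {A B : Scheme.{u}} (f : A ⟶ B) [IsOpenImmersion f] :
    PreservesFiniteLimits (Scheme.Modules.restrictFunctor f) where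
  preservesFiniteLimits J _ _ := by
    have : PreservesLimitsOfShape J ((Functor.whiskeringLeft _ _ Ab.{u}).obj f.opensFunctor.op) :=
      inferInstance
    have h : PreservesLimitsOfShape J
        (Scheme.Modules.restrictFunctor f ⋙ Scheme.Modules.toPresheaf A) :=
      inferInstanceAs (PreservesLimitsOfShape J (Scheme.Modules.toPresheaf B ⋙
        (Functor.whiskeringLeft _ _ Ab.{u}).obj f.opensFunctor.op))
    have := reflectsLimitsOfShape_of_reflectsIsomorphisms (J := J) (G := Scheme.Modules.toPresheaf A)
    exact preservesLimitsOfShape_of_reflects_of_preserves (Scheme.Modules.restrictFunctor f)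
      (Scheme.Modules.toPresheaf A)

instance {A B : Scheme.{u}} (f : A ⟶ B) [IsOpenImmersion f] :
    (Scheme.Modules.restrictFunctor f).Additive :=
  Functor.additive_of_preserves_binary_products _

instance {A B : Scheme.{u}} (f : A ⟶ B) [IsOpenImmersion f] :
    (Scheme.Modules.restrictFunctor f).PreservesHomology := inferInstance

lemma isZero_restrict_iff {A : Scheme.{u}} (U : A.Opens) (M : A.Modules) :
    IsZero ((Scheme.Modules.restrictFunctor U.ι).obj M) ↔ ∀ x ∈ U, IsZero ((Scheme.Modules.toPresheaf A ⋙
      TopCat.Presheaf.stalkFunctor Ab.{u} x).obj M) := by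
  have e (x : U.toScheme) := (Scheme.Modules.restrictStalkNatIso U.ι x).app M
  refine ⟨fun h x hx => ?_, fun h => isZero_of_stalk _ fun x => ?_⟩
  · refine IsZero.of_iso ?_ (e ⟨x, hx⟩).symm
    have : (Scheme.Modules.toPresheaf U.toScheme).PreservesZeroMorphisms := ⟨fun _ _ => rfl⟩
    exact (TopCat.Presheaf.stalkFunctor Ab.{u} _).map_isZero
      ((Scheme.Modules.toPresheaf U.toScheme).map_isZero h)
  · exact (h _ x.2).of_iso (e x)

end Exact

namespace QCoh

variable (X : SuperRingedScheme.{u}) (U : X.even.Opens)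

/-- The functor `M ↦ M|_U` on quasi-coherent modules. -/
def restrictFunctor : QCoh X ⥤ QCoh (X.restrict U) :=
  (SuperModule.isQuasicoherent (X.restrict U)).lift
    ((SuperModule.isQuasicoherent X).ι ⋙ SuperModule.restrictFunctor U) fun M =>
      ⟨@Scheme.Modules.isQuasicoherent_restrictFunctor _ _ U.ι _ _ M.property.1,
       @Scheme.Modules.isQuasicoherent_restrictFunctor _ _ U.ι _ _ M.property.2⟩

instance : (restrictFunctor X U).Additive where
  map_add := rfl

end QCoh

section Derived

variable (X : SuperRingedScheme.{u}) (U : X.even.Opens)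

lemma acyclic_iff (K : KQCoh X) : acyclic X K ↔
    ∀ n : ℤ, IsZero (((QCoh.evenPart X).mapHomotopyCategory (ComplexShape.up ℤ) ⋙
        HomotopyCategory.homologyFunctor X.even.Modules (ComplexShape.up ℤ) n).obj K) ∧
      IsZero (((QCoh.oddPart X).mapHomotopyCategory (ComplexShape.up ℤ) ⋙
        HomotopyCategory.homologyFunctor X.even.Modules (ComplexShape.up ℤ) n).obj K) := by
  simp only [forall_and]
  exact and_congr (HomotopyCategory.mem_subcategoryAcyclic_iff _)
    (HomotopyCategory.mem_subcategoryAcyclic_iff _)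

/-- Termwise restriction of complexes to `U`. -/
def KQCoh.restrictFunctor : KQCoh X ⥤ KQCoh (X.restrict U) :=
  (QCoh.restrictFunctor X U).mapHomotopyCategory (ComplexShape.up ℤ)

instance : (KQCoh.restrictFunctor X U).CommShift ℤ :=
  inferInstanceAs (((QCoh.restrictFunctor X U).mapHomotopyCategory (ComplexShape.up ℤ)).CommShift ℤ)

instance : (KQCoh.restrictFunctor X U).IsTriangulated :=
  inferInstanceAs
    (((QCoh.restrictFunctor X U).mapHomotopyCategory (ComplexShape.up ℤ)).IsTriangulated)

lemma nonempty_homology_evenPart_restrict (K : KQCoh X) (n : ℤ) :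
    Nonempty (((QCoh.evenPart (X.restrict U)).mapHomotopyCategory (ComplexShape.up ℤ) ⋙
        HomotopyCategory.homologyFunctor (X.restrict U).even.Modules (ComplexShape.up ℤ) n).obj
          ((KQCoh.restrictFunctor X U).obj K) ≅
      (Scheme.Modules.restrictFunctor U.ι).obj
        (((QCoh.evenPart X).mapHomotopyCategory (ComplexShape.up ℤ) ⋙
        HomotopyCategory.homologyFunctor X.even.Modules (ComplexShape.up ℤ) n).obj K)) := by
  obtain ⟨L, rfl⟩ := HomotopyCategory.quotient_obj_surjective K
  let L' := ((QCoh.evenPart X).mapHomologicalComplex (ComplexShape.up ℤ)).obj L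
  refine ⟨(HomotopyCategory.homologyFunctorFactors _ (ComplexShape.up ℤ) n).app
    (((Scheme.Modules.restrictFunctor U.ι).mapHomologicalComplex _).obj L') ≪≫ ?_ ≪≫
    (Scheme.Modules.restrictFunctor U.ι).mapIso
      ((HomotopyCategory.homologyFunctorFactors _ (ComplexShape.up ℤ) n).app L').symm⟩
  exact (L'.sc n).mapHomologyIso (Scheme.Modules.restrictFunctor U.ι)

lemma nonempty_homology_oddPart_restrict (K : KQCoh X) (n : ℤ) :
    Nonempty (((QCoh.oddPart (X.restrict U)).mapHomotopyCategory (ComplexShape.up ℤ) ⋙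
        HomotopyCategory.homologyFunctor (X.restrict U).even.Modules (ComplexShape.up ℤ) n).obj
          ((KQCoh.restrictFunctor X U).obj K) ≅
      (Scheme.Modules.restrictFunctor U.ι).obj
        (((QCoh.oddPart X).mapHomotopyCategory (ComplexShape.up ℤ) ⋙
        HomotopyCategory.homologyFunctor X.even.Modules (ComplexShape.up ℤ) n).obj K)) := by
  obtain ⟨L, rfl⟩ := HomotopyCategory.quotient_obj_surjective K
  let L' := ((QCoh.oddPart X).mapHomologicalComplex (ComplexShape.up ℤ)).obj L
  refine ⟨(HomotopyCategory.homologyFunctorFactors _ (ComplexShape.up ℤ) n).app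
    (((Scheme.Modules.restrictFunctor U.ι).mapHomologicalComplex _).obj L') ≪≫ ?_ ≪≫
    (Scheme.Modules.restrictFunctor U.ι).mapIso
      ((HomotopyCategory.homologyFunctorFactors _ (ComplexShape.up ℤ) n).app L').symm⟩
  exact (L'.sc n).mapHomologyIso (Scheme.Modules.restrictFunctor U.ι)

lemma acyclic_restrict_iff (K : KQCoh X) :
    acyclic (X.restrict U) ((KQCoh.restrictFunctor X U).obj K) ↔ ∀ n : ℤ,
      IsZero ((Scheme.Modules.restrictFunctor U.ι).obj
        (((QCoh.evenPart X).mapHomotopyCategory (ComplexShape.up ℤ) ⋙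
        HomotopyCategory.homologyFunctor X.even.Modules (ComplexShape.up ℤ) n).obj K)) ∧
      IsZero ((Scheme.Modules.restrictFunctor U.ι).obj
        (((QCoh.oddPart X).mapHomotopyCategory (ComplexShape.up ℤ) ⋙
        HomotopyCategory.homologyFunctor X.even.Modules (ComplexShape.up ℤ) n).obj K)) := by
  rw [acyclic_iff]
  exact forall_congr' fun n => and_congr
    (nonempty_homology_evenPart_restrict X U K n).some.isZero_iff
    (nonempty_homology_oddPart_restrict X U K n).some.isZero_iff

lemma acyclic_le_restrict :
    acyclic X ≤ (acyclic (X.restrict U)).inverseImage (KQCoh.restrictFunctor X U) := by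
  intro K hK
  rw [ObjectProperty.prop_inverseImage_iff, acyclic_restrict_iff]
  rw [acyclic_iff] at hK
  exact fun n => ⟨Functor.map_isZero _ (hK n).1, Functor.map_isZero _ (hK n).2⟩

instance : (acyclic X).IsClosedUnderIsomorphisms := by
  unfold acyclic; infer_instance

lemma restrictFunctor_inverts : (acyclic X).trW.IsInvertedBy
    (KQCoh.restrictFunctor X U ⋙ (acyclic (X.restrict U)).trW.Q) := fun _ _ f hf =>
  ObjectProperty.inverseImage_trW_isInverted (acyclic (X.restrict U)) (KQCoh.restrictFunctor X U)
    (acyclic (X.restrict U)).trW.Q f (ObjectProperty.trW_monotone (acyclic_le_restrict X U) f hf)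

/-- The restriction functor `j^* : D_qc(X) → D_qc(U)`. -/
def jstar : Dqc X ⥤ Dqc (X.restrict U) :=
  Localization.lift (KQCoh.restrictFunctor X U ⋙ (acyclic (X.restrict U)).trW.Q)
    (restrictFunctor_inverts X U) (acyclic X).trW.Q

/-- On complexes, `j^*` is the termwise restriction. -/
def jstarFac : (acyclic X).trW.Q ⋙ jstar X U ≅
    KQCoh.restrictFunctor X U ⋙ (acyclic (X.restrict U)).trW.Q :=
  Localization.fac _ (restrictFunctor_inverts X U) _

instance : Localization.Lifting (acyclic X).trW.Q (acyclic X).trW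
    (KQCoh.restrictFunctor X U ⋙ (acyclic (X.restrict U)).trW.Q) (jstar X U) :=
  ⟨jstarFac X U⟩

instance : (jstar X U).CommShift ℤ :=
  Functor.commShiftOfLocalization (acyclic X).trW.Q (acyclic X).trW ℤ
    (KQCoh.restrictFunctor X U ⋙ (acyclic (X.restrict U)).trW.Q) (jstar X U)

instance : NatTrans.CommShift (jstarFac X U).hom ℤ :=
  inferInstanceAs (NatTrans.CommShift (Localization.Lifting.iso (acyclic X).trW.Q (acyclic X).trW
    (KQCoh.restrictFunctor X U ⋙ (acyclic (X.restrict U)).trW.Q) (jstar X U)).hom ℤ)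

instance : (jstar X U).IsTriangulated :=
  have := Localization.essSurj_mapArrow (acyclic X).trW.Q (acyclic X).trW
  Functor.isTriangulated_of_precomp_iso (jstarFac X U)

lemma evenPart_inverts (n : ℤ) : (acyclic X).trW.IsInvertedBy
    ((QCoh.evenPart X).mapHomotopyCategory (ComplexShape.up ℤ) ⋙
      HomotopyCategory.homologyFunctor X.even.Modules (ComplexShape.up ℤ) n) := by
  intro K L f hf
  have h := (ObjectProperty.inverseImage_trW_iff _ _ _).1 (ObjectProperty.trW_monotone
    (inf_le_left : acyclic X ≤ _) f hf)
  rw [← HomotopyCategory.quasiIso_eq_trW_subcategoryAcyclic] at h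
  exact h n

lemma oddPart_inverts (n : ℤ) : (acyclic X).trW.IsInvertedBy
    ((QCoh.oddPart X).mapHomotopyCategory (ComplexShape.up ℤ) ⋙
      HomotopyCategory.homologyFunctor X.even.Modules (ComplexShape.up ℤ) n) := by
  intro K L f hf
  have h := (ObjectProperty.inverseImage_trW_iff _ _ _).1 (ObjectProperty.trW_monotone
    (inf_le_right : acyclic X ≤ _) f hf)
  rw [← HomotopyCategory.quasiIso_eq_trW_subcategoryAcyclic] at h
  exact h n

/-- The even part of the cohomology sheaf `H^n(F)`. -/
def cohomologyEven (n : ℤ) : Dqc X ⥤ X.even.Modules :=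
  Localization.lift _ (evenPart_inverts X n) (acyclic X).trW.Q

/-- The odd part of the cohomology sheaf `H^n(F)`. -/
def cohomologyOdd (n : ℤ) : Dqc X ⥤ X.even.Modules :=
  Localization.lift _ (oddPart_inverts X n) (acyclic X).trW.Q

/-- The homological support of `F`: the union over `n` of the supports
`{x | H^n(F)_x ≠ 0}` of the cohomology sheaves. -/
def supph {X : SuperRingedScheme.{u}} (F : Dqc X) : Set X.even :=
  {x | ∃ n : ℤ,
    ¬ (IsZero ((Scheme.Modules.toPresheaf X.even ⋙ TopCat.Presheaf.stalkFunctor Ab.{u} x).obj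
        ((cohomologyEven X n).obj F)) ∧
      IsZero ((Scheme.Modules.toPresheaf X.even ⋙ TopCat.Presheaf.stalkFunctor Ab.{u} x).obj
        ((cohomologyOdd X n).obj F)))}

/-- The objects of `D_{qc,Z}(X)`: those with homological support contained in `Z`. -/
def DqcSupp (Z : Closeds X.even) : ObjectProperty (Dqc X) := fun F => supph F ⊆ Z

lemma isZero_obj_of_isZero_Q_obj {E : Type*} [Category* E] [HasZeroMorphisms E]
    (G : KQCoh X ⥤ E) [G.PreservesZeroMorphisms] (hG : (acyclic X).trW.IsInvertedBy G)
    (K : KQCoh X) (h : IsZero ((acyclic X).trW.Q.obj K)) : IsZero (G.obj K) := by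
  let e := Localization.fac G hG (acyclic X).trW.Q
  have h0 : (acyclic X).trW.Q.map (𝟙 K) = (acyclic X).trW.Q.map 0 := h.eq_of_src _ _
  rw [IsZero.iff_id_eq_zero, ← G.map_id, ← NatIso.naturality_1 e, Functor.comp_map, h0,
    ← Functor.comp_map, NatIso.naturality_1 e, G.map_zero]

open ZeroObject in
lemma isZero_Q_obj_iff (K : KQCoh X) : IsZero ((acyclic X).trW.Q.obj K) ↔ acyclic X K := by
  constructor
  · intro h
    rw [acyclic_iff]
    exact fun n => ⟨isZero_obj_of_isZero_Q_obj X _ (evenPart_inverts X n) K h,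
      isZero_obj_of_isZero_Q_obj X _ (oddPart_inverts X n) K h⟩
  · intro h
    have h1 : (acyclic X).trW (0 : 0 ⟶ K) :=
      ObjectProperty.trW.mk _ (Pretriangulated.contractible_distinguished₁ K) h
    have := Localization.inverts (acyclic X).trW.Q (acyclic X).trW _ h1
    exact ((acyclic X).trW.Q.map_isZero (isZero_zero _)).of_iso
      (asIso ((acyclic X).trW.Q.map (0 : 0 ⟶ K))).symm

lemma supph_eq_of_iso {F G : Dqc X} (e : F ≅ G) : supph F = supph G := by
  ext x
  refine exists_congr fun n => not_congr (and_congr ?_ ?_)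
  · exact Iso.isZero_iff (Functor.mapIso _ (Functor.mapIso _ e))
  · exact Iso.isZero_iff (Functor.mapIso _ (Functor.mapIso _ e))

lemma dqcSupp_iff (Z : Closeds X.even) (F : Dqc X) :
    DqcSupp X Z F ↔ IsZero ((jstar X Z.compl).obj F) := by
  have := Localization.essSurj (acyclic X).trW.Q (acyclic X).trW
  let K := (acyclic X).trW.Q.objPreimage F
  let e : (acyclic X).trW.Q.obj K ≅ F := (acyclic X).trW.Q.objObjPreimageIso F
  have h1 : DqcSupp X Z F ↔ DqcSupp X Z ((acyclic X).trW.Q.obj K) := by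
    simp only [DqcSupp, supph_eq_of_iso X e]
  have h4 : IsZero ((jstar X Z.compl).obj ((acyclic X).trW.Q.obj K)) ↔
      acyclic (X.restrict Z.compl) ((KQCoh.restrictFunctor X Z.compl).obj K) :=
    ((jstarFac X Z.compl).app K).isZero_iff.trans (isZero_Q_obj_iff _ _)
  rw [h1, ← ((jstar X Z.compl).mapIso e).isZero_iff, h4, acyclic_restrict_iff]
  simp only [isZero_restrict_iff]
  have e0 (n : ℤ) := (Localization.fac _ (evenPart_inverts X n) (acyclic X).trW.Q).app K
  have e1 (n : ℤ) := (Localization.fac _ (oddPart_inverts X n) (acyclic X).trW.Q).app K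
  have h2 (n : ℤ) (x : X.even) := (Functor.mapIso (Scheme.Modules.toPresheaf X.even ⋙
    TopCat.Presheaf.stalkFunctor Ab.{u} x) (e0 n)).isZero_iff
  have h3 (n : ℤ) (x : X.even) := (Functor.mapIso (Scheme.Modules.toPresheaf X.even ⋙
    TopCat.Presheaf.stalkFunctor Ab.{u} x) (e1 n)).isZero_iff
  simp only [← h2, ← h3]
  constructor
  · intro h n
    have h' (x) (hx : x ∈ Z.compl) := not_not.1 (not_exists.1 (fun hn => hx (h hn)) n)
    exact ⟨fun x hx => (h' x hx).1, fun x hx => (h' x hx).2⟩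
  · rintro h x ⟨n, hn⟩
    by_contra hx
    exact hn ⟨(h n).1 x hx, (h n).2 x hx⟩

instance (Z : Closeds X.even) : (DqcSupp X Z).IsClosedUnderIsomorphisms where
  of_iso e h := by
    rw [dqcSupp_iff] at h ⊢
    exact h.of_iso ((jstar X Z.compl).mapIso e.symm)

/-- `D_{qc,Z}(X)` is a triangulated subcategory of `D_qc(X)`. -/
instance (Z : Closeds X.even) : (DqcSupp X Z).IsTriangulated where
  exists_zero := ⟨_, isZero_zero _, (dqcSupp_iff X Z _).2
    ((jstar X Z.compl).map_isZero (isZero_zero _))⟩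
  isStableUnderShiftBy n := ⟨fun F hF => by
    rw [ObjectProperty.prop_shift_iff, dqcSupp_iff]
    rw [dqcSupp_iff] at hF
    exact ((shiftFunctor _ n).map_isZero hF).of_iso (((jstar X Z.compl).commShiftIso n).app F)⟩
  toIsTriangulatedClosed₂ := .mk' fun T hT h₁ h₃ => by
    rw [dqcSupp_iff] at h₁ h₃ ⊢
    exact Pretriangulated.Triangle.isZero₂_of_isZero₁₃ _ ((jstar X Z.compl).map_distinguished T hT) h₁ h₃

/-- The functor `j^*` inverts the morphisms whose cone is in `D_{qc,Z}(X)`. -/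
lemma jstar_inverts (Z : Closeds X.even) :
    (DqcSupp X Z).trW.IsInvertedBy (jstar X Z.compl) := by
  rintro F G f ⟨H, g, h, hT, hH⟩
  rw [dqcSupp_iff] at hH
  exact (Pretriangulated.Triangle.isZero₃_iff_isIso₁ _ ((jstar X Z.compl).map_distinguished _ hT)).1 hH

/-- The Verdier quotient `D_qc(X) / D_{qc,Z}(X)`. -/
abbrev DqcQuotient (Z : Closeds X.even) : Type (u + 1) := (DqcSupp X Z).trW.Localization

/-- The functor `D_qc(X) / D_{qc,Z}(X) → D_qc(U)` induced by `j^*`, where `U` is the complement of `Z`. -/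
def jstarQuotient (Z : Closeds X.even) : DqcQuotient X Z ⥤ Dqc (X.restrict Z.compl) :=
  Localization.lift (jstar X Z.compl) (jstar_inverts X Z) (DqcSupp X Z).trW.Q

/-- The composition of the quotient functor and the induced functor is `j^*`. -/
def jstarQuotientFac (Z : Closeds X.even) :
    (DqcSupp X Z).trW.Q ⋙ jstarQuotient X Z ≅ jstar X Z.compl :=
  Localization.fac _ (jstar_inverts X Z) _

instance (Z : Closeds X.even) : Localization.Lifting (DqcSupp X Z).trW.Q (DqcSupp X Z).trW
    (jstar X Z.compl) (jstarQuotient X Z) :=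
  ⟨jstarQuotientFac X Z⟩

instance (Z : Closeds X.even) : (jstarQuotient X Z).CommShift ℤ :=
  Functor.commShiftOfLocalization (DqcSupp X Z).trW.Q (DqcSupp X Z).trW ℤ
    (jstar X Z.compl) (jstarQuotient X Z)

instance (Z : Closeds X.even) : NatTrans.CommShift (jstarQuotientFac X Z).hom ℤ :=
  inferInstanceAs (NatTrans.CommShift (Localization.Lifting.iso (DqcSupp X Z).trW.Q
    (DqcSupp X Z).trW (jstar X Z.compl) (jstarQuotient X Z)).hom ℤ)

instance (Z : Closeds X.even) : (jstarQuotient X Z).IsTriangulated :=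
  have := Localization.essSurj_mapArrow (DqcSupp X Z).trW.Q (DqcSupp X Z).trW
  Functor.isTriangulated_of_precomp_iso (jstarQuotientFac X Z)

end Derived

end SuperRingedScheme

end

/-! Write `j` for the open immersion of `U`. Restriction `j^*` of quasi-coherent modules has a right
adjoint `j_*` with invertible counit `j^* j_* ⟶ 1`. Both functors are additive, so they act termwise
on complexes, and the adjunction with its invertible counit survives on the homotopy categories. A
functor with a fully faithful right adjoint is a localization at the morphisms it inverts, so `K(X)
⥤ K(U)` is a localization.

Composing with `K(U) ⥤ D(U)` gives a localization of `K(X)` at the morphisms that become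
quasi-isomorphisms on `U` (`isLocalization_restrictFunctor_comp`). The termwise `j_*` need not
preserve quasi-isomorphisms, but this does not matter: a quasi-isomorphism `f` on `U` is isomorphic
to `j^* j_* f`, so it comes from a morphism of `K(X)` in the required class. Neither a derived
direct image nor resolutions are needed.

This localization factors through `D(X)`, so `j^* : D(X) ⥤ D(U)` is itself a localization, at the
morphisms it inverts. Since `j^*` is triangulated and kills exactly the objects supported on `Z`,
these are the morphisms with cone supported on `Z` (`isLocalization_jstar`). The Verdier quotient is
a localization at the same class, and uniqueness of localizations concludes.

The geometric input is that `j_*` preserves quasi-coherence when `j` is quasi-compact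
(`isQuasicoherent_pushforward`). On an affine target this says that sections over `D(r)` are the
localization at `r` of the global sections. It follows from the sheaf property and a finite cover of
the preimage of `U` by basic opens. -/

noncomputable section

/-! ### Modules on an affine scheme whose sections localize -/

namespace AlgebraicGeometry.Scheme.Modules

variable {R : CommRingCat.{u}}

/-- Restriction of sections of a module on `Spec R`, as an `R`-linear map. -/
def resSpec (N : (Spec R).Modules) {V W : (Spec R).Opens} (h : W ≤ V) : Γ(N, V) →ₗ[R] Γ(N, W) :=
  ((modulesSpecToSheaf.obj N).obj.map (homOfLE h).op).hom

lemma resSpec_apply (N : (Spec R).Modules) {V W : (Spec R).Opens} (h : W ≤ V) (s : Γ(N, V)) :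
    resSpec N h s = N.presheaf.map (homOfLE h).op s := rfl

@[simp]
lemma resSpec_resSpec (N : (Spec R).Modules) {V W T : (Spec R).Opens} (h : W ≤ V) (k : T ≤ W)
    (s : Γ(N, V)) : resSpec N k (resSpec N h s) = resSpec N (k.trans h) s := by
  simp only [resSpec_apply, ← N.presheaf.map_comp_apply]
  rfl

/-- The basic open `D(r)` of `Spec R`. -/
def specBasicOpen (r : R) : (Spec R).Opens := PrimeSpectrum.basicOpen r

/-- The sections of `N` over `V ∩ D(r)` are the localization at `r` of the sections over `V`,
for all `r`. -/
structure IsLocalizingOn (N : (Spec R).Modules) (V : (Spec R).Opens) : Prop where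
  existence (r : R) (s : Γ(N, V ⊓ specBasicOpen r)) :
    ∃ (n : ℕ) (t : Γ(N, V)), resSpec N inf_le_left t = r ^ n • s
  uniqueness (r : R) (t : Γ(N, V)) (ht : resSpec N
    (inf_le_left : V ⊓ specBasicOpen r ≤ V) t = 0) : ∃ n : ℕ, r ^ n • t = 0

/-- Of the three conditions for a localized module, invertibility of `r` on sections over `D(r)`
holds for every module. Only extension of sections up to a power of `r` and vanishing up to a power
of `r` remain. -/
lemma isLocalizing_iff_isLocalizingOn_top (N : (Spec R).Modules) :
    IsLocalizing (modulesSpecToSheaf.obj N) ↔ IsLocalizingOn N ⊤ := by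
  -- The open set is a variable because `⊤ ⊓ specBasicOpen r` equals `specBasicOpen r` only
  -- propositionally.
  have key (r : R) (V : (Spec R).Opens) (hV : V = specBasicOpen r) :
      IsLocalizedModule (.powers r) ((modulesSpecToSheaf.obj N).obj.map
          (PrimeSpectrum.basicOpen r).leTop.op).hom ↔
      (∀ s : Γ(N, V), ∃ (n : ℕ) (t : Γ(N, ⊤)), resSpec N le_top t = r ^ n • s) ∧
      (∀ t : Γ(N, ⊤), resSpec N (le_top : V ≤ ⊤) t = 0 → ∃ n : ℕ, r ^ n • t = 0) := by
    subst hV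
    let φ := ((modulesSpecToSheaf.obj N).obj.map (PrimeSpectrum.basicOpen r).leTop.op).hom
    refine ⟨fun h => ⟨fun s => ?_, fun t ht => ?_⟩,
      fun h => IsLocalizedModule.Away.mk_of_addCommGroup ?_ ?_ ?_⟩
    · have h' : IsLocalizedModule.Away r φ := h
      obtain ⟨n, y, hy⟩ := h'.surj _ _ s
      exact ⟨n, y, hy.symm⟩
    · obtain ⟨⟨_, n, rfl⟩, hn⟩ := (IsLocalizedModule.eq_zero_iff (.powers r) φ).mp ht
      exact ⟨n, hn⟩
    · exact isUnit_algebraMap_end_of_le_basicOpen r le_rfl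
    · intro x
      obtain ⟨n, t, ht⟩ := h.1 x
      exact ⟨n, t, ht.symm⟩
    · exact h.2
  have key' (r : R) := key r (⊤ ⊓ specBasicOpen r) (top_inf_eq _)
  exact ⟨fun h => ⟨fun r => ((key' r).1 (h r)).1, fun r => ((key' r).1 (h r)).2⟩,
    fun h r => (key' r).2 ⟨h.1 r, h.2 r⟩⟩

/-- Restriction identifies the sections over `V` and `V ∩ D(r)` with those over `V'` and `V' ∩
D(r)`. The typical case is a direct image from `V'`, which does not see the rest of `V`. -/
lemma IsLocalizingOn.iff_of_bijective (N : (Spec R).Modules) {V V' : (Spec R).Opens} (h : V' ≤ V)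
    (hb : ∀ T ≤ V, Function.Bijective (resSpec N (inf_le_left : T ⊓ V' ≤ T))) :
    IsLocalizingOn N V ↔ IsLocalizingOn N V' := by
  have hb' (T T' : (Spec R).Opens) (hT : T ≤ V) (hT' : T' = T ⊓ V') :
      ∃ h : T' ≤ T, Function.Bijective (resSpec N h) := by
    subst hT'
    exact ⟨_, hb T hT⟩
  obtain ⟨_, h1⟩ := hb' V V' le_rfl (by simpa using h)
  have h2 (r : R) := hb' (V ⊓ specBasicOpen r) (V' ⊓ specBasicOpen r)
    inf_le_left (by rw [inf_right_comm, inf_eq_right.2 h])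
  choose h2 h3 using h2
  refine ⟨fun H => ⟨fun r s => ?_, fun r t ht => ?_⟩, fun H => ⟨fun r s => ?_, fun r t ht => ?_⟩⟩
  · obtain ⟨s, rfl⟩ := (h3 r).2 s
    obtain ⟨n, t, ht⟩ := H.existence r s
    exact ⟨n, resSpec N h t, by simpa using congr(resSpec N (h2 r) $ht)⟩
  · obtain ⟨t, rfl⟩ := h1.2 t
    obtain ⟨n, hn⟩ := H.uniqueness r t ((h3 r).1 (by simpa using ht))
    exact ⟨n, by simpa using congr(resSpec N h $hn)⟩
  · obtain ⟨n, t, ht⟩ := H.existence r (resSpec N (h2 r) s)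
    obtain ⟨t, rfl⟩ := h1.2 t
    exact ⟨n, t, (h3 r).1 (by simpa using ht)⟩
  · obtain ⟨n, hn⟩ := H.uniqueness r (resSpec N h t) (by simpa using congr(resSpec N (h2 r) $ht))
    exact ⟨n, h1.1 (by simpa using hn)⟩

lemma resSpec_ext (N : (Spec R).Modules) {ι : Type*} {V : (Spec R).Opens} (W : ι → (Spec R).Opens)
    (hW : ∀ i, W i ≤ V) (hV : V ≤ iSup W) {s t : Γ(N, V)}
    (h : ∀ i, resSpec N (hW i) s = resSpec N (hW i) t) : s = t :=
  TopCat.Sheaf.eq_of_locally_eq' ⟨_, N.isSheaf⟩ W V (fun i => homOfLE (hW i)) hV s t h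

lemma exists_resSpec_eq (N : (Spec R).Modules) {ι : Type*} {V : (Spec R).Opens}
    (W : ι → (Spec R).Opens) (hW : ∀ i, W i ≤ V) (hV : V ≤ iSup W) (s : ∀ i, Γ(N, W i))
    (h : ∀ i j, resSpec N (inf_le_left : W i ⊓ W j ≤ W i) (s i) = resSpec N inf_le_right (s j)) :
    ∃ t : Γ(N, V), ∀ i, resSpec N (hW i) t = s i :=
  have h' : TopCat.Presheaf.IsCompatible N.presheaf W s := h
  (TopCat.Sheaf.existsUnique_gluing' ⟨_, N.isSheaf⟩ W V (fun i => homOfLE (hW i)) hV s h').exists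

/-- The sheaf condition for a finite cover is a finite limit, and localization at `r` is exact, so
it commutes with it. The argument below is this fact spelled out with exponents. -/
lemma IsLocalizingOn.iSup (N : (Spec R).Modules) {ι : Type*} [Finite ι] (V : ι → (Spec R).Opens)
    (h₁ : ∀ i, IsLocalizingOn N (V i)) (h₂ : ∀ i j, IsLocalizingOn N (V i ⊓ V j)) :
    IsLocalizingOn N (⨆ i, V i) := by
  have hV (i) : V i ≤ ⨆ i, V i := le_iSup V i
  have hVr (r : R) (i) : V i ⊓ specBasicOpen r ≤ (⨆ i, V i) ⊓ specBasicOpen r :=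
    inf_le_inf_right _ (hV i)
  have hcov (r : R) : (⨆ i, V i) ⊓ specBasicOpen r ≤
      ⨆ i, V i ⊓ specBasicOpen r := (iSup_inf_eq _ _).le
  -- Finiteness of the cover enters here: exponents found piece by piece have a common upper bound.
  have bound {κ : Type _} [Finite κ] (n : κ → ℕ) : ∃ K, ∀ i, ∃ m, K = m + n i := by
    obtain ⟨K, hK⟩ := Set.finite_range n |>.bddAbove
    exact ⟨K, fun i => ⟨K - n i, (Nat.sub_add_cancel (hK ⟨i, rfl⟩)).symm⟩⟩
  refine ⟨fun r s => ?_, fun r t ht => ?_⟩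
  · choose n t ht using fun i => (h₁ i).existence r (resSpec N (hVr r i) s)
    obtain ⟨K, hK⟩ := bound n
    choose m hm using hK
    have ht' (i) : resSpec N inf_le_left (r ^ m i • t i) = r ^ K • resSpec N (hVr r i) s := by
      rw [_root_.map_smul, ht, hm i, pow_add, mul_smul]
    -- The local extensions of `r ^ K • s` agree over `D(r)`, so on each overlap a further power of
    -- `r` kills their difference.
    choose l hl using fun p : ι × ι => (h₂ p.1 p.2).uniqueness r
      (resSpec N inf_le_left (r ^ m p.1 • t p.1) - resSpec N inf_le_right (r ^ m p.2 • t p.2)) (by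
        have e₁ := congr(resSpec N (inf_le_inf_right (specBasicOpen r)
          (inf_le_left : V p.1 ⊓ V p.2 ≤ V p.1)) $(ht' p.1))
        have e₂ := congr(resSpec N (inf_le_inf_right (specBasicOpen r)
          (inf_le_right : V p.1 ⊓ V p.2 ≤ V p.2)) $(ht' p.2))
        simp only [map_sub, resSpec_resSpec, _root_.map_smul] at e₁ e₂ ⊢
        rw [e₁, e₂, sub_self])
    obtain ⟨L, hL⟩ := bound l
    choose k hk using hL
    obtain ⟨y, hy⟩ := exists_resSpec_eq N V hV le_rfl (fun i => r ^ L • r ^ m i • t i) (by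
      intro i j
      have := congr(r ^ k (i, j) • $(hl (i, j)))
      rw [← mul_smul, ← pow_add, ← hk] at this
      simpa only [smul_sub, smul_zero, sub_eq_zero, _root_.map_smul] using this)
    -- `K` pays for extending `s` to each piece, `L` for making the extensions agree on overlaps.
    refine ⟨L + K, y, resSpec_ext N _ (hVr r) (hcov r) fun i => ?_⟩
    have := congr(resSpec N (inf_le_left : V i ⊓ specBasicOpen r ≤ V i) $(hy i))
    rw [resSpec_resSpec, _root_.map_smul, ht'] at this
    rw [resSpec_resSpec, this, _root_.map_smul, pow_add, mul_smul]
  · choose n hn using fun i => (h₁ i).uniqueness r (resSpec N (hV i) t) (by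
      simpa using congr(resSpec N (hVr r i) $ht))
    obtain ⟨K, hK⟩ := bound n
    refine ⟨K, resSpec_ext N V hV le_rfl fun i => ?_⟩
    obtain ⟨m, hm⟩ := hK i
    rw [_root_.map_smul, hm, pow_add, mul_smul, hn, smul_zero, map_zero]

lemma bijective_map_of_eq {A : Scheme.{u}} (M : A.Modules) {V W : A.Opens} (i : W ⟶ V)
    (h : W = V) : Function.Bijective (M.presheaf.map i.op) := by
  subst h
  have : i = 𝟙 _ := Subsingleton.elim _ _
  subst this
  rw [op_id, M.presheaf.map_id]
  exact Function.bijective_id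

/-- Both sides are sections of `M` over the same open set, since `T` and its intersection with the
range of `f` have the same preimage. -/
lemma bijective_resSpec_pushforward {A : Scheme.{u}} (f : A ⟶ Spec R) [IsOpenImmersion f]
    (M : A.Modules) (T : (Spec R).Opens) : Function.Bijective
      (resSpec ((pushforward f).obj M) (inf_le_left : T ⊓ f.opensRange ≤ T)) := by
  have h : f ⁻¹ᵁ (T ⊓ f.opensRange) = f ⁻¹ᵁ T := by
    rw [Scheme.Hom.preimage_inf, Scheme.Hom.preimage_opensRange, inf_top_eq]
  exact bijective_map_of_eq M ((Opens.map f.base).map (homOfLE inf_le_left)) h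

/-- Compare `N` with `P = ψ_* ψ^* N` through the adjunction unit, which is bijective over opens
inside the range of `ψ`. Since `ψ` comes from a ring map, `P` is localizing on all of `Spec R`. Its
sections are unchanged by intersecting with the range, so it is localizing there too, and the
property passes back to `N`. -/
lemma isLocalizingOn_of_isQuasicoherent_restrict (N : (Spec R).Modules) {S : CommRingCat.{u}}
    (ψ : Spec S ⟶ Spec R) [IsOpenImmersion ψ] [(N.restrict ψ).IsQuasicoherent] :
    IsLocalizingOn N ψ.opensRange := by
  obtain ⟨φ, rfl⟩ := Spec.map_surjective ψ
  let P := (pushforward (Spec.map φ)).obj (N.restrict (Spec.map φ))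
  have hP : IsLocalizingOn P (Spec.map φ).opensRange := by
    rw [← IsLocalizingOn.iff_of_bijective P le_top, ← isLocalizing_iff_isLocalizingOn_top]
    · exact isLocalizing_pushforward_of_isLocalizing φ
        ((isIso_fromTildeΓ_iff_isLocalizing _).1 inferInstance)
    · exact fun T _ => bijective_resSpec_pushforward _ _ _
  let u : N ⟶ P := (restrictAdjunction (Spec.map φ)).unit.app N
  let v (V) : Γ(N, V) →ₗ[R] Γ(P, V) := ((modulesSpecToSheaf.map u).hom.app (op V)).hom
  have hv (V W : (Spec R).Opens) (h : W ≤ V) (s : Γ(N, V)) :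
      resSpec P h (v V s) = v W (resSpec N h s) :=
    congr(($((modulesSpecToSheaf.map u).hom.naturality (homOfLE h).op)).hom s).symm
  have hb (V : (Spec R).Opens) (hV : V ≤ (Spec.map φ).opensRange) : Function.Bijective (v V) :=
    bijective_map_of_eq N (homOfLE ((Spec.map φ).image_preimage_le V)) (by
      rw [Scheme.Hom.image_preimage_eq_opensRange_inf, inf_eq_right.2 hV])
  refine ⟨fun r s => ?_, fun r t ht => ?_⟩
  · obtain ⟨n, t, ht⟩ := hP.existence r (v _ s)
    obtain ⟨t, rfl⟩ := (hb _ le_rfl).2 t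
    exact ⟨n, t, (hb _ inf_le_left).1 (by simpa [hv] using ht)⟩
  · obtain ⟨n, hn⟩ := hP.uniqueness r (v _ t) (by simp [hv, ht])
    exact ⟨n, (hb _ le_rfl).1 (by simpa using hn)⟩

/-- The sections of `N` live on `W`, which is a finite union of basic opens by quasi-compactness.
Overlaps are again basic opens, `D(a) ∩ D(b) = D(ab)`, so the affine case applies to pieces and
overlaps alike. -/
lemma isLocalizingOn_top_of_isCompact (N : (Spec R).Modules) (W : (Spec R).Opens)
    (hW : IsCompact (W : Set (Spec R)))
    (hb : ∀ T, Function.Bijective (resSpec N (inf_le_left : T ⊓ W ≤ T)))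
    (hq : ∀ (S : CommRingCat.{u}) (ψ : Spec S ⟶ Spec R) [IsOpenImmersion ψ],
      ψ.opensRange ≤ W → (N.restrict ψ).IsQuasicoherent) : IsLocalizingOn N ⊤ := by
  rw [IsLocalizingOn.iff_of_bijective N (le_top : W ≤ ⊤) fun T _ => hb T]
  have hg (g : R) (h : specBasicOpen g ≤ W) : IsLocalizingOn N (specBasicOpen g) := by
    let ψ := Spec.map (CommRingCat.ofHom (algebraMap R (Localization.Away g)))
    have hψ : ψ.opensRange = specBasicOpen g :=
      TopologicalSpace.Opens.ext (PrimeSpectrum.localization_away_comap_range _ g)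
    rw [← hψ] at h ⊢
    have := hq _ ψ h
    exact isLocalizingOn_of_isQuasicoherent_restrict N ψ
  obtain ⟨κ, hκ, a, ha⟩ :=
    PrimeSpectrum.isBasis_basic_opens.exists_iSup_eq_of_isCompact W hW
  have ha' : W = ⨆ i, specBasicOpen (a i) := ha
  have hle (i) : specBasicOpen (a i) ≤ W := ha' ▸ le_iSup (fun i => specBasicOpen (a i)) i
  rw [ha']
  refine IsLocalizingOn.iSup N _ (fun i => hg _ (hle i)) fun i j => ?_
  have h : specBasicOpen (a i) ⊓ specBasicOpen (a j) = specBasicOpen (a i * a j) :=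
    (PrimeSpectrum.basicOpen_mul _ _).symm
  rw [h]
  exact hg _ (h ▸ inf_le_left.trans (hle i))

end AlgebraicGeometry.Scheme.Modules

/-! ### Direct images along quasi-compact open immersions -/

/-- Quasi-coherence is local on the target, so it is tested on an affine open `f : Spec R ⟶ A`.
There the direct image has its sections concentrated on the preimage of `U`, and on affine opens
inside that preimage it is a restriction of `M`. -/
lemma SuperRingedScheme.isQuasicoherent_pushforward {A : Scheme.{u}} (U : A.Opens)
    (hU : IsRetrocompact (U : Set A)) (M : U.toScheme.Modules) [M.IsQuasicoherent] :
    ((Scheme.Modules.pushforward U.ι).obj M).IsQuasicoherent := by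
  refine isQuasicoherent_of_affine _ fun R f _ => ?_
  let N := ((Scheme.Modules.pushforward U.ι).obj M).restrict f
  suffices h : IsIso N.fromTildeΓ from ⟨_, ⟨asIso N.fromTildeΓ⟩⟩
  rw [isIso_fromTildeΓ_iff_isLocalizing, Scheme.Modules.isLocalizing_iff_isLocalizingOn_top]
  refine Scheme.Modules.isLocalizingOn_top_of_isCompact N (f ⁻¹ᵁ U) ?_ (fun T => ?_)
    (fun S ψ _ hψ => ?_)
  · have := hU (isCompact_range f.continuous) f.isOpenEmbedding.isOpen_range
    have h := (f.isOpenEmbedding.isInducing.isCompact_preimage_iff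
      (K := U ∩ Set.range f) Set.inter_subset_right).2 this
    simpa using h
  · exact Scheme.Modules.bijective_map_of_eq M _ (by
      ext x
      constructor
      · rintro ⟨y, hy, hxy⟩
        exact ⟨y, hy.1, hxy⟩
      · rintro ⟨y, hy, hxy⟩
        exact ⟨y, ⟨hy, by change f y ∈ U; exact hxy ▸ x.2⟩, hxy⟩)
  · let h : Spec S ⟶ U := IsOpenImmersion.lift U.ι (ψ ≫ f) (by
      rintro _ ⟨y, rfl⟩
      exact ⟨⟨f (ψ y), hψ ⟨y, rfl⟩⟩, rfl⟩)
    have hh : h ≫ U.ι = ψ ≫ f := IsOpenImmersion.lift_fac _ _ _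
    have : IsOpenImmersion h := by
      have : IsOpenImmersion (h ≫ U.ι) := by rw [hh]; infer_instance
      exact IsOpenImmersion.of_comp h U.ι
    let e := (Scheme.Modules.restrictFunctorComp ψ f).symm ≪≫
      Scheme.Modules.restrictFunctorCongr hh.symm ≪≫ Scheme.Modules.restrictFunctorComp h U.ι
    let e' : N.restrict ψ ≅ M.restrict h := e.app ((Scheme.Modules.pushforward U.ι).obj M) ≪≫
      (Scheme.Modules.restrictFunctor h).mapIso
        ((Scheme.Modules.restrictFunctorAdjCounitIso U.ι).app M)
    exact (SheafOfModules.isQuasicoherent (Spec S).ringCatSheaf).prop_of_iso e'.symm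
      (Scheme.Modules.isQuasicoherent_restrictFunctor h M)

/-! ### Direct images of graded modules and the adjunction with restriction -/

namespace SuperRingedScheme

variable (X : SuperRingedScheme.{u}) (U : X.even.Opens)

namespace SuperModule

lemma smul_left_congr {A : Scheme.{u}} (P : A.Modules) {V : A.Opens} {r s : Γ(A, V)} (h : r = s)
    (m : Γ(P, V)) : r • m = s • m := by rw [h]

/-- Restriction of odd sections from `V` to `V ∩ U`. -/
def resOdd (V : X.even.Opens) : Γ(X.odd, V) →+ Γ(X.odd.restrict U.ι, U.ι ⁻¹ᵁ V) :=
  (X.odd.presheaf.map (homOfLE (U.ι.image_preimage_le V)).op).hom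

/-- `resOdd` is the component at `V` of the adjunction unit of `X.odd`, which is a morphism of
modules. -/
lemma resOdd_smul (V : X.even.Opens) (r : Γ(X.even, V)) (a : Γ(X.odd, V)) :
    resOdd X U V (r • a) = (U.ι.app V r : Γ(U.toScheme, U.ι ⁻¹ᵁ V)) • resOdd X U V a :=
  ((Scheme.Modules.restrictAdjunction U.ι).unit.app X.odd).app_smul r a

/-- This compatibility gives the associativity axioms of the odd action on direct images. -/
lemma mul_resOdd (V : X.even.Opens) (a b : Γ(X.odd, V)) :
    (X.restrict U).mul (U.ι ⁻¹ᵁ V) (resOdd X U V a) (resOdd X U V b) =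
      (U.ι.app V (X.mul V a b) : Γ(U.toScheme, U.ι ⁻¹ᵁ V)) := by
  rw [Scheme.Opens.ι_app]
  exact (X.map_mul _ a b).symm

lemma map_resOdd {V W : X.even.Opens} (i : W ⟶ V) (a : Γ(X.odd, V)) :
    (X.restrict U).odd.presheaf.map ((Opens.map U.ι.base).map i).op (resOdd X U V a) =
      resOdd X U W (X.odd.presheaf.map i.op a) :=
  congr(($(((Scheme.Modules.restrictAdjunction U.ι).unit.app
    X.odd).mapPresheaf.naturality i.op)) a).symm

variable {X U}

/-- The bilinear map on direct images induced by a bilinear map over `U`. -/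
def pushforwardBilin {P Q : U.toScheme.Modules} (V : X.even.Opens)
    (B : Γ(X.odd.restrict U.ι, U.ι ⁻¹ᵁ V) →ₗ[Γ(U.toScheme, U.ι ⁻¹ᵁ V)] Γ(P, U.ι ⁻¹ᵁ V)
      →ₗ[Γ(U.toScheme, U.ι ⁻¹ᵁ V)] Γ(Q, U.ι ⁻¹ᵁ V)) :
    Γ(X.odd, V) →ₗ[Γ(X.even, V)] Γ((Scheme.Modules.pushforward U.ι).obj P, V) →ₗ[Γ(X.even, V)]
      Γ((Scheme.Modules.pushforward U.ι).obj Q, V) :=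
  LinearMap.mk₂ Γ(X.even, V) (fun a b => (B (resOdd X U V a) b : Γ(Q, U.ι ⁻¹ᵁ V)))
    (fun a a' b => by rw [map_add]; exact B.map_add₂ _ _ b)
    (fun r a b => by rw [resOdd_smul]; exact B.map_smul₂ _ _ b)
    (fun a b b' => (B _).map_add b b')
    (fun r a b => (B _).map_smul _ b)

/-- The direct image `j_* M` along the inclusion `j` of `U`. -/
def pushforward (M : SuperModule (X.restrict U)) : SuperModule X where
  even := (Scheme.Modules.pushforward U.ι).obj M.even
  odd := (Scheme.Modules.pushforward U.ι).obj M.odd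
  actEven V := pushforwardBilin V (M.actEven (U.ι ⁻¹ᵁ V))
  actOdd V := pushforwardBilin V (M.actOdd (U.ι ⁻¹ᵁ V))
  map_actEven i a m := (M.map_actEven ((Opens.map U.ι.base).map i) _ m).trans
    congr(M.actEven _ $(map_resOdd X U i a) _)
  map_actOdd i a m := (M.map_actOdd ((Opens.map U.ι.base).map i) _ m).trans
    congr(M.actOdd _ $(map_resOdd X U i a) _)
  actOdd_actEven V a b m := (M.actOdd_actEven (U.ι ⁻¹ᵁ V) _ _ m).trans
    (smul_left_congr M.even (mul_resOdd X U V a b) m)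
  actEven_actOdd V a b m := (M.actEven_actOdd (U.ι ⁻¹ᵁ V) _ _ m).trans
    (smul_left_congr M.odd (mul_resOdd X U V a b) m)

variable (X U) in
/-- The functor `j_*`. -/
def pushforwardFunctor : SuperModule (X.restrict U) ⥤ SuperModule X where
  obj M := M.pushforward
  map f :=
    { even := (Scheme.Modules.pushforward U.ι).map f.even
      odd := (Scheme.Modules.pushforward U.ι).map f.odd
      app_actEven V a m := f.app_actEven (U.ι ⁻¹ᵁ V) (resOdd X U V a) m
      app_actOdd V a m := f.app_actOdd (U.ι ⁻¹ᵁ V) (resOdd X U V a) m }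
  map_id _ := rfl
  map_comp _ _ := rfl

variable (U) in
/-- The unit `M ⟶ j_* j^* M`. -/
def toPushforwardRestrict (M : SuperModule X) : M ⟶ (M.restrict U).pushforward where
  even := (Scheme.Modules.restrictAdjunction U.ι).unit.app M.even
  odd := (Scheme.Modules.restrictAdjunction U.ι).unit.app M.odd
  app_actEven V a m := M.map_actEven (homOfLE (U.ι.image_preimage_le V)) a m
  app_actOdd V a m := M.map_actOdd (homOfLE (U.ι.image_preimage_le V)) a m

/-- The two restrictions compose to restriction along an identity, although `U.ι ⁻¹ᵁ (U.ι ''ᵁ V)` is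
`V` only up to a propositional equality. The counit needs this to commute with the odd action. -/
lemma map_resOdd_image (V : U.toScheme.Opens) (a : Γ(X.odd, U.ι ''ᵁ V)) :
    (X.restrict U).odd.presheaf.map (eqToHom (U.ι.preimage_image_eq V).symm).op
      (resOdd X U (U.ι ''ᵁ V) a) = a := by
  change (X.odd.presheaf.map _ ≫ X.odd.presheaf.map _) a = a
  rw [← X.odd.presheaf.map_comp]
  exact congr($(X.odd.presheaf.map_id _) a)

/-- The counit `j^* j_* M ⟶ M`. -/
def ofRestrictPushforward (M : SuperModule (X.restrict U)) : M.pushforward.restrict U ⟶ M where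
  even := (Scheme.Modules.restrictAdjunction U.ι).counit.app M.even
  odd := (Scheme.Modules.restrictAdjunction U.ι).counit.app M.odd
  app_actEven V a m := (M.map_actEven (eqToHom (U.ι.preimage_image_eq V).symm) _ m).trans
    congr(M.actEven V $(map_resOdd_image V a) _)
  app_actOdd V a m := (M.map_actOdd (eqToHom (U.ι.preimage_image_eq V).symm) _ m).trans
    congr(M.actOdd V $(map_resOdd_image V a) _)

variable (X U) in
/-- The adjunction between `j^*` and `j_*`. -/
def restrictAdjunction :
    (restrictFunctor U : SuperModule X ⥤ _) ⊣ pushforwardFunctor X U where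
  unit :=
    { app M := toPushforwardRestrict U M
      naturality M N f := by
        ext1
        · exact (Scheme.Modules.restrictAdjunction U.ι).unit.naturality f.even
        · exact (Scheme.Modules.restrictAdjunction U.ι).unit.naturality f.odd }
  counit :=
    { app M := ofRestrictPushforward M
      naturality M N f := by
        ext1
        · exact (Scheme.Modules.restrictAdjunction U.ι).counit.naturality f.even
        · exact (Scheme.Modules.restrictAdjunction U.ι).counit.naturality f.odd }
  left_triangle_components M := by
    ext1
    · exact (Scheme.Modules.restrictAdjunction U.ι).left_triangle_components M.even
    · exact (Scheme.Modules.restrictAdjunction U.ι).left_triangle_components M.odd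
  right_triangle_components M := by
    ext1
    · exact (Scheme.Modules.restrictAdjunction U.ι).right_triangle_components M.even
    · exact (Scheme.Modules.restrictAdjunction U.ι).right_triangle_components M.odd

/-- A morphism is an isomorphism when its homogeneous parts are. -/
lemma isIso_of_isIso {M N : SuperModule X} (f : M ⟶ N) [IsIso f.even] [IsIso f.odd] : IsIso f := by
  have h₀ (V : X.even.Opens) (m) : f.even.app V ((inv f.even).app V m) = m :=
    congr(($(IsIso.inv_hom_id f.even)).app V m)
  have h₁ (V : X.even.Opens) (m) : f.odd.app V ((inv f.odd).app V m) = m :=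
    congr(($(IsIso.inv_hom_id f.odd)).app V m)
  have h₀' (V : X.even.Opens) (m) : (inv f.even).app V (f.even.app V m) = m :=
    congr(($(IsIso.hom_inv_id f.even)).app V m)
  have h₁' (V : X.even.Opens) (m) : (inv f.odd).app V (f.odd.app V m) = m :=
    congr(($(IsIso.hom_inv_id f.odd)).app V m)
  let g : N ⟶ M :=
    { even := inv f.even
      odd := inv f.odd
      app_actEven V a m := by
        conv_lhs => rw [← h₀ V m]
        rw [← f.app_actEven, h₁']
      app_actOdd V a m := by
        conv_lhs => rw [← h₁ V m]
        rw [← f.app_actOdd, h₀'] }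
  exact ⟨g, by ext1 <;> exact IsIso.hom_inv_id _, by ext1 <;> exact IsIso.inv_hom_id _⟩

/-- Invertibility is checked on the even and odd parts, where it is the statement `j^* j_* ≅ 1` for
an open immersion of schemes. Full faithfulness of `j_*` follows. -/
instance : IsIso (restrictAdjunction X U).counit := by
  have (M : SuperModule (X.restrict U)) : IsIso ((restrictAdjunction X U).counit.app M) := by
    have : IsIso ((restrictAdjunction X U).counit.app M).even :=
      NatIso.isIso_app_of_isIso (Scheme.Modules.restrictAdjunction U.ι).counit M.even
    have : IsIso ((restrictAdjunction X U).counit.app M).odd :=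
      NatIso.isIso_app_of_isIso (Scheme.Modules.restrictAdjunction U.ι).counit M.odd
    exact isIso_of_isIso _
  exact NatIso.isIso_of_isIso_app _

instance : (pushforwardFunctor X U).Full :=
  (restrictAdjunction X U).fullyFaithfulROfIsIsoCounit.full
instance : (pushforwardFunctor X U).Faithful :=
  (restrictAdjunction X U).fullyFaithfulROfIsIsoCounit.faithful

end SuperModule

end SuperRingedScheme

/-! ### Adjunctions on homotopy categories -/

namespace CategoryTheory

variable {C D : Type*} [Category* C] [Category* D] [Preadditive C] [Preadditive D]

/-- An adjunction between additive functors induces an adjunction on homotopy categories. -/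
def Adjunction.mapHomotopyCategory {ι : Type*} {F : C ⥤ D} {G : D ⥤ C} [F.Additive] [G.Additive]
    (adj : F ⊣ G) (c : ComplexShape ι) : F.mapHomotopyCategory c ⊣ G.mapHomotopyCategory c where
  unit :=
    { app K := (HomotopyCategory.quotient C c).map
        ((NatTrans.mapHomologicalComplex adj.unit c).app K.as)
      naturality := by
        rintro ⟨K⟩ ⟨L⟩ ⟨f : K ⟶ L⟩
        exact congr((HomotopyCategory.quotient C c).map
          $((NatTrans.mapHomologicalComplex adj.unit c).naturality f)) }
  counit :=
    { app K := (HomotopyCategory.quotient D c).map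
        ((NatTrans.mapHomologicalComplex adj.counit c).app K.as)
      naturality := by
        rintro ⟨K⟩ ⟨L⟩ ⟨f : K ⟶ L⟩
        exact congr((HomotopyCategory.quotient D c).map
          $((NatTrans.mapHomologicalComplex adj.counit c).naturality f)) }
  left_triangle_components K := by
    -- The triangle identity already holds for chain maps, degree by degree, before homotopy classes
    -- are taken.
    refine Eq.trans (congr_arg (HomotopyCategory.quotient D c).map (a₂ := 𝟙 _) ?_)
      ((HomotopyCategory.quotient D c).map_id _)
    ext i
    exact adj.left_triangle_components (K.as.X i)
  right_triangle_components K := by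
    refine Eq.trans (congr_arg (HomotopyCategory.quotient C c).map (a₂ := 𝟙 _) ?_)
      ((HomotopyCategory.quotient C c).map_id _)
    ext i
    exact adj.right_triangle_components (K.as.X i)

end CategoryTheory

/-! ### Direct images of quasi-coherent modules and of their complexes -/

namespace SuperRingedScheme

variable (X : SuperRingedScheme.{u}) (U : X.even.Opens)

namespace QCoh

variable {X U}

/-- The functor `j_*` on quasi-coherent modules, for a quasi-compact inclusion `j`. -/
def pushforwardFunctor (hU : IsRetrocompact (U : Set X.even)) : QCoh (X.restrict U) ⥤ QCoh X :=
  (SuperModule.isQuasicoherent X).lift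
    ((SuperModule.isQuasicoherent (X.restrict U)).ι ⋙ SuperModule.pushforwardFunctor X U) fun M =>
      ⟨@isQuasicoherent_pushforward _ U hU _ M.property.1,
       @isQuasicoherent_pushforward _ U hU _ M.property.2⟩

variable (hU : IsRetrocompact (U : Set X.even))

instance : (pushforwardFunctor hU).Additive where
  map_add := rfl

/-- Full faithfulness passes to complexes and, since homotopies lift as well, to the homotopy
categories. There it makes restriction a localization. -/
instance : (pushforwardFunctor hU).Full :=
  have := Functor.Full.comp (SuperModule.isQuasicoherent (X.restrict U)).ι
    (SuperModule.pushforwardFunctor X U)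
  Functor.Full.of_comp_faithful_iso (G := (SuperModule.isQuasicoherent X).ι) (Iso.refl
    ((SuperModule.isQuasicoherent (X.restrict U)).ι ⋙ SuperModule.pushforwardFunctor X U))

instance : (pushforwardFunctor hU).Faithful :=
  have := Functor.Faithful.comp (SuperModule.isQuasicoherent (X.restrict U)).ι
    (SuperModule.pushforwardFunctor X U)
  Functor.Faithful.of_comp_iso (G := (SuperModule.isQuasicoherent X).ι) (Iso.refl
    ((SuperModule.isQuasicoherent (X.restrict U)).ι ⋙ SuperModule.pushforwardFunctor X U))

/-- The adjunction between `j^*` and `j_*` on quasi-coherent modules. -/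
def restrictAdjunction : restrictFunctor X U ⊣ pushforwardFunctor hU :=
  (SuperModule.restrictAdjunction X U).restrictFullyFaithful
    (SuperModule.isQuasicoherent X).fullyFaithfulι
    (SuperModule.isQuasicoherent (X.restrict U)).fullyFaithfulι (Iso.refl _) (Iso.refl _)

end QCoh

variable {U}

namespace KQCoh

variable {X} (hU : IsRetrocompact (U : Set X.even))

/-- Termwise direct image of complexes. -/
abbrev pushforwardFunctor : KQCoh (X.restrict U) ⥤ KQCoh X :=
  (QCoh.pushforwardFunctor hU).mapHomotopyCategory (ComplexShape.up ℤ)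

/-- The adjunction between `j^*` and `j_*` on complexes. -/
def restrictAdjunction : restrictFunctor X U ⊣ pushforwardFunctor hU :=
  (QCoh.restrictAdjunction hU).mapHomotopyCategory (ComplexShape.up ℤ)

end KQCoh

/-! ### Restriction as a localization -/

variable (U) in
/-- The morphisms of complexes which become quasi-isomorphisms on `U`. -/
abbrev restrictQuasiIso : MorphismProperty (KQCoh X) :=
  (MorphismProperty.isomorphisms _).inverseImage
    (KQCoh.restrictFunctor X U ⋙ (acyclic (X.restrict U)).trW.Q)

/-- Both factors are localizations: the first because its right adjoint `j_*` is fully faithful, the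
second by definition. The composite is then a localization once every quasi-isomorphism on `U` is,
up to isomorphism, the restriction of a morphism in the given class. -/
lemma isLocalization_restrictFunctor_comp (hU : IsRetrocompact (U : Set X.even)) :
    (KQCoh.restrictFunctor X U ⋙ (acyclic (X.restrict U)).trW.Q).IsLocalization
      (restrictQuasiIso X U) := by
  let adj := KQCoh.restrictAdjunction hU
  have := adj.isLocalization
  refine Functor.IsLocalization.comp _ _
    ((MorphismProperty.isomorphisms _).inverseImage (KQCoh.restrictFunctor X U))
    (acyclic (X.restrict U)).trW _ (fun _ _ _ hf => hf) ?_ ?_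
  · intro K L f (hf : IsIso ((KQCoh.restrictFunctor X U).map f))
    exact Functor.map_isIso (acyclic (X.restrict U)).trW.Q ((KQCoh.restrictFunctor X U).map f)
  · intro K L f hf
    let G := KQCoh.pushforwardFunctor hU
    -- The lift of `f` to `X` is `j_* f`. It need not be a quasi-isomorphism on `X`; it only has to
    -- become one on `U`, which the counit provides.
    have e : Arrow.mk ((KQCoh.restrictFunctor X U).map (G.map f)) ≅ Arrow.mk f :=
      Arrow.isoMk (asIso (adj.counit.app K)) (asIso (adj.counit.app L))
        (adj.counit.naturality f).symm
    refine (MorphismProperty.arrow_mk_iso_iff _ e).1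
      (MorphismProperty.map_mem_map _ _ (G.map f) ?_)
    have h : (acyclic (X.restrict U)).trW ((KQCoh.restrictFunctor X U).map (G.map f)) :=
      ((acyclic (X.restrict U)).trW.arrow_mk_iso_iff e).2 hf
    exact Localization.inverts (acyclic (X.restrict U)).trW.Q (acyclic (X.restrict U)).trW _ h

/-- `K(X) ⥤ D(X)` and the composite `K(X) ⥤ D(U)` are localizations, hence so is the second factor
`j^*`, at the image in `D(X)` of the class inverted by the composite. It remains to recognize that
image as the morphisms with cone supported on `Z`. -/
lemma isLocalization_jstar (Z : Closeds X.even) (hU : IsRetrocompact (Z.compl : Set X.even)) :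
    (jstar X Z.compl).IsLocalization (DqcSupp X Z).trW := by
  have h₁ := isLocalization_restrictFunctor_comp X hU
  have h₂ : ((acyclic X).trW.Q ⋙ jstar X Z.compl).IsLocalization (restrictQuasiIso X Z.compl) :=
    Functor.IsLocalization.of_iso _ (jstarFac X Z.compl).symm
  have := Localization.essSurj_mapArrow (acyclic X).trW.Q (acyclic X).trW
  -- `j^*` is triangulated, so it inverts `f` exactly when it kills a cone of `f`, that is, when the
  -- cone is supported on `Z`.
  have h₃ {F G : Dqc X} (f : F ⟶ G) : (DqcSupp X Z).trW f ↔ IsIso ((jstar X Z.compl).map f) := by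
    refine ⟨jstar_inverts X Z f, fun h => ?_⟩
    obtain ⟨H, g, k, hT⟩ := Pretriangulated.distinguished_cocone_triangle f
    refine ObjectProperty.trW.mk _ hT ((dqcSupp_iff X Z H).2 ?_)
    exact (Pretriangulated.Triangle.isZero₃_iff_isIso₁ _
      ((jstar X Z.compl).map_distinguished _ hT)).2 h
  have h₄ {K L : KQCoh X} (f : K ⟶ L) : restrictQuasiIso X Z.compl f ↔
      IsIso ((jstar X Z.compl).map ((acyclic X).trW.Q.map f)) :=
    (NatIso.isIso_map_iff (jstarFac X Z.compl) f).symm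
  refine Functor.IsLocalization.of_comp (acyclic X).trW.Q (jstar X Z.compl) (acyclic X).trW _
    (restrictQuasiIso X Z.compl) ?_ (le_antisymm ?_ ?_)
  · exact restrictFunctor_inverts X Z.compl
  · intro F G f hf
    -- By the calculus of fractions, every morphism of `D(X)` is isomorphic, as an arrow, to the
    -- image of a morphism of complexes, so `f` may be taken of that form.
    let e := (acyclic X).trW.Q.mapArrow.objObjPreimageIso (Arrow.mk f)
    refine (MorphismProperty.arrow_mk_iso_iff _ e).1 (MorphismProperty.map_mem_map _ _ _ ?_)
    rw [h₄, ← h₃]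
    exact ((DqcSupp X Z).trW.arrow_mk_iso_iff e).2 hf
  · rw [MorphismProperty.map_le_iff]
    intro K L f hf
    exact (h₃ _).2 ((h₄ f).1 hf)

end SuperRingedScheme

end

theorem mainTheorem6 (X : SuperRingedScheme.{u}) [X.IsSuperscheme] (hX : X.IsSplit)
    (Z : TopologicalSpace.Closeds X.even) (hU : IsRetrocompact (Z.compl : Set X.even)) :
    (SuperRingedScheme.jstarQuotient X Z).IsEquivalence := by
  have := SuperRingedScheme.isLocalization_jstar X Z hU
  let W := (SuperRingedScheme.DqcSupp X Z).trW
  let j := SuperRingedScheme.jstar X Z.compl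
  -- The quotient functor and `j^*` are localizations at the same class `W`. The quasi-inverse is
  -- the factorization of the quotient functor through `j^*`.
  exact Localization.isEquivalence W.Q W j W j _ W.Q
    (Localization.lift W.Q (Localization.inverts W.Q W) j)
    (Localization.fac _ _ _) (SuperRingedScheme.jstarQuotientFac X Z)
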